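/- Let $\mathbb T$ be a dependent type theory with the four forms of judgement $A\in\mathsf{Type}$, $a\in A$, $A=B\in\mathsf{Type}$, $a=b\in A$ (relative to contexts), whose derivable judgements satisfy the usual presuppositions and are closed under the structural rules (assumption, weakening, substitution, definitional equality as an equivalence relation compatible with typing and with substitution) and under the rules for identity types, all relative to an arbitrary context $\Gamma$ and commuting with substitution: from $a,b\in A$ infer $\mathrm{Id}_A(a,b)\in\mathsf{Type}$; from $a\in A$ infer $r(a)\in\mathrm{Id}_A(a,a)$; and, for every dependent context $\Theta(x,y,u)$ relative to $(x\in A,\,y\in A,\,u\in\mathrm{Id}_A(x,y))$ and every type $C(x,y,u)$ in context $(x\in A,\,y\in A,\,u\in\mathrm{Id}_A(x,y),\,\Theta(x,y,u))$, from $p\in\mathrm{Id}_A(a,b)$ and $(x\in A,\Theta(x,x,r(x)))\ d(x)\in C(x,x,r(x))$ infer $(\Theta(a,b,p))\ J(a,b,p,d)\in C(a,b,p)$, with $J(a,a,r(a),d)=d(a)$. Let $\mathcal C(\mathbb T)$ be the classifying category of $\mathbb T$, whose objects are contexts and whose maps are context morphisms (tuples of terms) up to definitional equality, with substitution as composition.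 Let $\mathcal D$ be the class of display maps $(\Gamma,x\in A)\to\Gamma$, let $\mathcal A$ be the class of maps with the left lifting property with respect to all maps in $\mathcal D$, and let $\mathcal B$ be the class of maps with the right lifting property with respect to all maps in $\mathcal A$. For a context $\Phi$, possibly relative to another context, the identity context $\mathrm{Id}_\Phi(x,y)$, relative to $(x\in\Phi,y\in\Phi)$, is defined by induction on the length of $\Phi$: it is empty if $\Phi$ is, and for $\Phi'=(x\in\Phi,z\in A(x))$, $$\mathrm{Id}_{\Phi'}\big((x,z),(y,w)\big)=\big(u\in\mathrm{Id}_\Phi(x,y),\ v\in\mathrm{Id}_{A(y)}(u_!(z),w)\big),$$ where $u_!(z)\in A(y)$ is given by elimination on $u$, with $r(x)_!(z)=z$. The fundamental groupoid $\mathcal F(\Phi)$ has as objects the global elements $a:(\,)\to\Phi$ and as maps $a\to b$ the elements of $\mathrm{Id}_\Phi(a,b)$ (paths) up to homotopy, where $p,q\in\mathrm{Id}_\Phi(a,b)$ are homotopic if there is an element of $\mathrm{Id}_{\mathrm{Id}_\Phi(a,b)}(p,q)$; composition, identities and inverses are given by composition of paths, reflexivity and inversion of paths. A context morphism $f:\Phi\to\Psi$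 induces a functor $\mathcal F(f):\mathcal F(\Phi)\to\mathcal F(\Psi)$, with $a\mapsto f(a)$ on objects and $[p]\mapsto[f(p)]$ on maps, where $f(p)\in\mathrm{Id}_\Psi(f(a),f(b))$ is given by elimination on $p$, with $f(r(a))=r(f(a))$; this makes $\mathcal F$ a functor from $\mathcal C(\mathbb T)$ to the category $\mathbf{Gpd}$ of small groupoids. **Theorem.** Let $f:\Phi\to\Psi$ be a context morphism. (i) If $f\in\mathcal A$, then $\mathcal F(f):\mathcal F(\Phi)\to\mathcal F(\Psi)$ is an equivalence of categories and is injective on objects. (ii) If $f\in\mathcal B$, then $\mathcal F(f):\mathcal F(\Phi)\to\mathcal F(\Psi)$ is a Grothendieck fibration. That is, $\mathcal F$ maps $\mathcal A$ and $\mathcal B$ into the classes of trivial cofibrations and of fibrations, respectively, of the natural model structure on $\mathbf{Gpd}$. -/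

import Mathlib

open CategoryTheory Limits

universe u

namespace TypeTheory

/-- A signature of symbols, other than those for identity types: `binders o` lists the arguments of
`o`, with the number of variables that `o` binds in each of them. -/
structure Signature where
  Op : Type u
  binders : Op → List ℕ

/-- Raw expressions with `n` free variables, up to renaming of bound variables (de Bruijn indices, the
index `0` being the variable declared last). `Id A a b` is `Id_A(a, b)`, `refl a` is `r(a)`, and
`J a b p d t` is the eliminator `J(a, b, p, [x] d)`, in which `d` may depend on the variable `x` and
on `k` parameters, with the terms `t` substituted for the parameters. -/
inductive Expr (S : Signature.{u}) : ℕ → Type u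
  | var {n : ℕ} (i : Fin n) : Expr S n
  | op {n : ℕ} (o : S.Op)
      (args : ∀ i : Fin (S.binders o).length, Expr S (n + (S.binders o).get i)) : Expr S n
  | Id {n : ℕ} (A a b : Expr S n) : Expr S n
  | refl {n : ℕ} (a : Expr S n) : Expr S n
  | J {n k : ℕ} (a b p : Expr S n) (d : Expr S (n + 1 + k)) (t : Fin k → Expr S n) : Expr S n

/-- The tuple `(a, s)`; index `0` is the most recently declared variable. -/
def scons {α : Type u} {n : ℕ} (a : α) (s : Fin n → α) : Fin (n + 1) → α := Fin.cases a s

@[simp] theorem scons_zero {α : Type u} {n : ℕ} (a : α) (s : Fin n → α) : scons a s 0 = a := rfl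
@[simp] theorem scons_succ {α : Type u} {n : ℕ} (a : α) (s : Fin n → α) (i : Fin n) :
    scons a s i.succ = s i := rfl

namespace Expr

variable {S : Signature.{u}}

/-- Extension of a renaming to one more variable. -/
def upR {m n : ℕ} (ρ : Fin m → Fin n) : Fin (m + 1) → Fin (n + 1) := Fin.cases 0 fun i => (ρ i).succ

def upRN {m n : ℕ} (ρ : Fin m → Fin n) : (k : ℕ) → Fin (m + k) → Fin (n + k)
  | 0 => ρ
  | k + 1 => upR (upRN ρ k)

/-- Renaming of variables. -/
def rename {m n : ℕ} (ρ : Fin m → Fin n) : Expr S m → Expr S n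
  | var i => var (ρ i)
  | op o args => op o fun i => (args i).rename (upRN ρ _)
  | Id A a b => Id (A.rename ρ) (a.rename ρ) (b.rename ρ)
  | refl a => refl (a.rename ρ)
  | @J _ _ k a b p d t =>
      J (a.rename ρ) (b.rename ρ) (p.rename ρ) (d.rename (upRN (upR ρ) k)) fun i => (t i).rename ρ

/-- The extension of a substitution to one more variable, which is left unchanged. -/
def up {m n : ℕ} (σ : Fin m → Expr S n) : Fin (m + 1) → Expr S (n + 1) :=
  scons (var 0) fun i => (σ i).rename Fin.succ

def upN {m n : ℕ} (σ : Fin m → Expr S n) : (k : ℕ) → Fin (m + k) → Expr S (n + k)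
  | 0 => σ
  | k + 1 => up (upN σ k)

/-- Simultaneous capture-avoiding substitution. -/
def subst {m n : ℕ} (σ : Fin m → Expr S n) : Expr S m → Expr S n
  | var i => σ i
  | op o args => op o fun i => (args i).subst (upN σ _)
  | Id A a b => Id (A.subst σ) (a.subst σ) (b.subst σ)
  | refl a => refl (a.subst σ)
  | @J _ _ k a b p d t =>
      J (a.subst σ) (b.subst σ) (p.subst σ) (d.subst (upN (up σ) k)) fun i => (t i).subst σ

theorem upN_var_comp {m n : ℕ} (ρ : Fin m → Fin n) (k : ℕ) :
    upN (S := S) (fun i => var (ρ i)) k = fun i => var (upRN ρ k i) := by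
  induction k with
  | zero => rfl
  | succ k ih =>
    funext i
    simp only [upN, ih, up, upRN, upR]
    refine Fin.cases ?_ (fun j => ?_) i <;> simp [rename]

theorem upN_succ {m n : ℕ} (σ : Fin m → Expr S n) (k : ℕ) : upN σ (k + 1) = up (upN σ k) := rfl
theorem upRN_succ {m n : ℕ} (ρ : Fin m → Fin n) (k : ℕ) : upRN ρ (k + 1) = upR (upRN ρ k) := rfl

theorem up_var_comp {m n : ℕ} (ρ : Fin m → Fin n) :
    up (S := S) (fun i => var (ρ i)) = fun i => var (upR ρ i) := upN_var_comp ρ 1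

theorem rename_eq_subst {m : ℕ} (e : Expr S m) : ∀ {n : ℕ} (ρ : Fin m → Fin n),
    e.rename ρ = e.subst fun i => var (ρ i) := by
  induction e with
  | var i => intros; rfl
  | op o args ih => intro n ρ; simp only [rename, subst, upN_var_comp, ih]
  | Id A a b h1 h2 h3 => intro n ρ; simp only [rename, subst, h1, h2, h3]
  | refl a h => intro n ρ; simp only [rename, subst, h]
  | J a b p d t h1 h2 h3 h4 h5 =>
    intro n ρ; simp only [rename, subst, h1, h2, h3, h4, h5, up_var_comp, upN_var_comp]

theorem upN_subst_rename {l m n : ℕ} (τ : Fin m → Expr S n) (ρ : Fin l → Fin m) (k : ℕ) :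
    (fun i => upN τ k (upRN ρ k i)) = upN (fun i => τ (ρ i)) k := by
  induction k with
  | zero => rfl
  | succ k ih =>
    rw [upN_succ, upN_succ, ← ih]
    funext i; refine Fin.cases rfl (fun j => rfl) i

theorem up_subst_rename {l m n : ℕ} (τ : Fin m → Expr S n) (ρ : Fin l → Fin m) :
    (fun i => up τ (upR ρ i)) = up (fun i => τ (ρ i)) := upN_subst_rename τ ρ 1

theorem subst_rename {l : ℕ} (e : Expr S l) : ∀ {m n : ℕ} (τ : Fin m → Expr S n) (ρ : Fin l → Fin m),
    (e.rename ρ).subst τ = e.subst fun i => τ (ρ i) := by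
  induction e with
  | var i => intros; rfl
  | op o args ih => intro m n τ ρ; simp only [rename, subst, ih, upN_subst_rename]
  | Id A a b h1 h2 h3 => intro m n τ ρ; simp only [rename, subst, h1, h2, h3]
  | refl a h => intro m n τ ρ; simp only [rename, subst, h]
  | J a b p d t h1 h2 h3 h4 h5 =>
    intro m n τ ρ
    simp only [rename, subst, h1, h2, h3, h4, h5, upN_subst_rename, up_subst_rename]

theorem rename_rename {l m n : ℕ} (e : Expr S l) (ρ : Fin l → Fin m) (ρ' : Fin m → Fin n) :
    (e.rename ρ).rename ρ' = e.rename fun i => ρ' (ρ i) := by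
  rw [rename_eq_subst (e.rename ρ), subst_rename, rename_eq_subst]

theorem upN_rename_subst {l m n : ℕ} (σ : Fin l → Expr S m) (ρ : Fin m → Fin n) (k : ℕ) :
    (fun i => (upN σ k i).rename (upRN ρ k)) = upN (fun i => (σ i).rename ρ) k := by
  induction k with
  | zero => rfl
  | succ k ih =>
    rw [upN_succ, upN_succ, ← ih]
    funext i
    refine Fin.cases rfl (fun j => ?_) i
    simp only [up, scons_succ, rename_rename, upRN_succ]
    rfl

theorem up_rename_subst {l m n : ℕ} (σ : Fin l → Expr S m) (ρ : Fin m → Fin n) :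
    (fun i => (up σ i).rename (upR ρ)) = up (fun i => (σ i).rename ρ) := upN_rename_subst σ ρ 1

theorem rename_subst {l : ℕ} (e : Expr S l) : ∀ {m n : ℕ} (σ : Fin l → Expr S m) (ρ : Fin m → Fin n),
    (e.subst σ).rename ρ = e.subst fun i => (σ i).rename ρ := by
  induction e with
  | var i => intros; rfl
  | op o args ih => intro m n τ ρ; simp only [rename, subst, ih, upN_rename_subst]
  | Id A a b h1 h2 h3 => intro m n τ ρ; simp only [rename, subst, h1, h2, h3]
  | refl a h => intro m n τ ρ; simp only [rename, subst, h]
  | J a b p d t h1 h2 h3 h4 h5 =>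
    intro m n τ ρ
    simp only [rename, subst, h1, h2, h3, h4, h5, upN_rename_subst, up_rename_subst]

theorem upN_subst_subst {l m n : ℕ} (σ : Fin l → Expr S m) (τ : Fin m → Expr S n) (k : ℕ) :
    (fun i => (upN σ k i).subst (upN τ k)) = upN (fun i => (σ i).subst τ) k := by
  induction k with
  | zero => rfl
  | succ k ih =>
    simp only [upN_succ]
    rw [← ih]
    funext i
    refine Fin.cases rfl (fun j => ?_) i
    simp only [up, scons_succ, subst_rename, rename_subst]

theorem up_subst_subst {l m n : ℕ} (σ : Fin l → Expr S m) (τ : Fin m → Expr S n) :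
    (fun i => (up σ i).subst (up τ)) = up (fun i => (σ i).subst τ) := upN_subst_subst σ τ 1

theorem subst_subst {l : ℕ} (e : Expr S l) : ∀ {m n : ℕ} (σ : Fin l → Expr S m)
    (τ : Fin m → Expr S n), (e.subst σ).subst τ = e.subst fun i => (σ i).subst τ := by
  induction e with
  | var i => intros; rfl
  | op o args ih => intro m n τ ρ; simp only [subst, ih, upN_subst_subst]
  | Id A a b h1 h2 h3 => intro m n τ ρ; simp only [subst, h1, h2, h3]
  | refl a h => intro m n τ ρ; simp only [subst, h]
  | J a b p d t h1 h2 h3 h4 h5 =>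
    intro m n τ ρ
    simp only [subst, h1, h2, h3, h4, h5, upN_subst_subst, up_subst_subst]

theorem upN_var {n : ℕ} (k : ℕ) : upN (S := S) (var (n := n)) k = var := by
  induction k with
  | zero => rfl
  | succ k ih =>
    rw [upN_succ, ih]; funext i; refine Fin.cases rfl (fun j => rfl) i

theorem up_var {n : ℕ} : up (S := S) (var (n := n)) = var := upN_var 1

@[simp] theorem subst_var {n : ℕ} (e : Expr S n) : e.subst var = e := by
  induction e with
  | var i => rfl
  | op o args ih => simp only [subst, upN_var, ih]
  | Id A a b h1 h2 h3 => simp only [subst, h1, h2, h3]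
  | refl a h => simp only [subst, h]
  | J a b p d t h1 h2 h3 h4 h5 =>
    simp only [subst, h1, h2, h3, h4, h5, up_var, upN_var]

end Expr

open TypeTheory.Expr

/-- Raw contexts with `n` variables. -/
inductive Ctx (S : Signature.{u}) : ℕ → Type u
  | nil : Ctx S 0
  | snoc {n : ℕ} (Γ : Ctx S n) (A : Expr S n) : Ctx S (n + 1)

/-- Raw dependent contexts of length `k` relative to a context with `n` variables. -/
inductive Tel (S : Signature.{u}) (n : ℕ) : ℕ → Type u
  | nil : Tel S n 0
  | snoc {k : ℕ} (Θ : Tel S n k) (A : Expr S (n + k)) : Tel S n (k + 1)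

/-- The concatenation `(Γ, Θ)`. -/
def Ctx.append {S : Signature.{u}} {n : ℕ} (Γ : Ctx S n) : {k : ℕ} → Tel S n k → Ctx S (n + k)
  | _, .nil => Γ
  | _, .snoc Θ A => (Γ.append Θ).snoc A

/-- Substitution in dependent contexts. -/
def Tel.subst {S : Signature.{u}} {m n : ℕ} (σ : Fin m → Expr S n) :
    {k : ℕ} → Tel S m k → Tel S n k
  | _, .nil => .nil
  | _, .snoc (k := k) Θ A => (Θ.subst σ).snoc (A.subst (upN σ k))

/-- The tuple `(σ, t)`. -/
def appendSub {S : Signature.{u}} {m n : ℕ} (σ : Fin m → Expr S n) :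
    {k : ℕ} → (Fin k → Expr S n) → Fin (m + k) → Expr S n
  | 0, _ => σ
  | _ + 1, t => scons (t 0) (appendSub σ fun i => t i.succ)

/-- The four forms of judgement: `A ∈ Type`, `a ∈ A`, `A = B ∈ Type`, `a = b ∈ A`. -/
inductive Judgement (S : Signature.{u}) (n : ℕ) : Type u
  | isType (A : Expr S n)
  | hasType (a A : Expr S n)
  | tyEq (A B : Expr S n)
  | tmEq (a b A : Expr S n)

def Judgement.subst {S : Signature.{u}} {m n : ℕ} (σ : Fin m → Expr S n) :
    Judgement S m → Judgement S n
  | isType A => isType (A.subst σ)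
  | hasType a A => hasType (a.subst σ) (A.subst σ)
  | tyEq A B => tyEq (A.subst σ) (B.subst σ)
  | tmEq a b A => tmEq (a.subst σ) (b.subst σ) (A.subst σ)

/-- The substitution that forgets the last variable. -/
def wk (S : Signature.{u}) (n : ℕ) : Fin n → Expr S (n + 1) := fun i => var i.succ

section Judging

variable {S : Signature.{u}} (H : ∀ n : ℕ, Ctx S n → Judgement S n → Prop)

/-- Well-formed contexts. -/
def WF : {n : ℕ} → Ctx S n → Prop
  | _, .nil => True
  | _, .snoc Γ A => WF Γ ∧ H _ Γ (.isType A)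

/-- `σ` is a context morphism from `Δ` to `Γ`: a tuple of terms in context `Δ`. -/
def IsSub {n : ℕ} (Δ : Ctx S n) : {m : ℕ} → Ctx S m → (Fin m → Expr S n) → Prop
  | _, .nil, _ => True
  | _, .snoc Γ A, σ => IsSub Δ Γ (fun i => σ i.succ) ∧
      H _ Δ (.hasType (σ 0) (A.subst fun i => σ i.succ))

/-- Componentwise definitional equality of context morphisms from `Δ` to `Γ`. -/
def SubEq {n : ℕ} (Δ : Ctx S n) : {m : ℕ} → Ctx S m → (Fin m → Expr S n) → (Fin m → Expr S n) → Prop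
  | _, .nil, _, _ => True
  | _, .snoc Γ A, σ, τ => SubEq Δ Γ (fun i => σ i.succ) (fun i => τ i.succ) ∧
      H _ Δ (.tmEq (σ 0) (τ 0) (A.subst fun i => σ i.succ))

end Judging

/-- `(Γ, x ∈ A, y ∈ A, u ∈ Id_A(x, y))`. -/
def Ctx.idCtx {S : Signature.{u}} {n : ℕ} (Γ : Ctx S n) (A : Expr S n) : Ctx S (n + 3) :=
  ((Γ.snoc A).snoc (A.subst (wk S n))).snoc
    (.Id ((A.subst (wk S n)).subst (wk S (n + 1))) (var 1) (var 0))

/-- `(x, x, r(x)) : (Γ, x ∈ A) → (Γ, x ∈ A, y ∈ A, u ∈ Id_A(x, y))`. -/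
def reflSub (S : Signature.{u}) (n : ℕ) : Fin (n + 3) → Expr S (n + 1) :=
  scons (.refl (var 0)) (scons (var 0) var)

/-- A dependent type theory with axioms for identity types: a signature `S` and a class `H` of derivable
judgements in context, closed under the structural rules (presuppositions, assumption, weakening,
substitution, equivalence and compatibility rules for definitional equality) and under the
formation, introduction, elimination and computation rules for identity types, the last two with a
dependent context `Θ` of parameters. All rules are relative to an arbitrary context `Γ`. The theory may
have any further symbols and derivable judgements. Substitution is simultaneous; it preserves
definitional equality, as is required for composition of context morphisms to be well defined.
The commutation of `Id`, `r` and `J` with substitution is part of the definition of `Expr.subst`. -/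
structure DependentTypeTheory where
  S : Signature.{u}
  H : ∀ n : ℕ, Ctx S n → Judgement S n → Prop
  wf {n : ℕ} {Γ : Ctx S n} {j : Judgement S n} : H n Γ j → WF H Γ
  isType_of_hasType {n : ℕ} {Γ : Ctx S n} {a A : Expr S n} :
    H n Γ (.hasType a A) → H n Γ (.isType A)
  isType_of_tyEq {n : ℕ} {Γ : Ctx S n} {A B : Expr S n} :
    H n Γ (.tyEq A B) → H n Γ (.isType A) ∧ H n Γ (.isType B)
  hasType_of_tmEq {n : ℕ} {Γ : Ctx S n} {a b A : Expr S n} :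
    H n Γ (.tmEq a b A) → H n Γ (.hasType a A) ∧ H n Γ (.hasType b A)
  assumption {n : ℕ} {Γ : Ctx S n} {A : Expr S n} :
    H n Γ (.isType A) → H (n + 1) (Γ.snoc A) (.hasType (var 0) (A.subst (wk S n)))
  weakening {n : ℕ} {Γ : Ctx S n} {A : Expr S n} {j : Judgement S n} :
    H n Γ j → H n Γ (.isType A) → H (n + 1) (Γ.snoc A) (j.subst (wk S n))
  substitution {m n : ℕ} {Γ : Ctx S m} {Δ : Ctx S n} {σ : Fin m → Expr S n} {j : Judgement S m} :
    H m Γ j → WF H Δ → IsSub H Δ Γ σ → H n Δ (j.subst σ)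
  substitution_type_congr {m n : ℕ} {Γ : Ctx S m} {Δ : Ctx S n} {σ τ : Fin m → Expr S n}
    {A : Expr S m} : H m Γ (.isType A) → WF H Δ → IsSub H Δ Γ σ → IsSub H Δ Γ τ →
    SubEq H Δ Γ σ τ → H n Δ (.tyEq (A.subst σ) (A.subst τ))
  substitution_term_congr {m n : ℕ} {Γ : Ctx S m} {Δ : Ctx S n} {σ τ : Fin m → Expr S n}
    {a A : Expr S m} : H m Γ (.hasType a A) → WF H Δ → IsSub H Δ Γ σ → IsSub H Δ Γ τ →
    SubEq H Δ Γ σ τ → H n Δ (.tmEq (a.subst σ) (a.subst τ) (A.subst σ))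
  ty_refl {n : ℕ} {Γ : Ctx S n} {A : Expr S n} : H n Γ (.isType A) → H n Γ (.tyEq A A)
  ty_symm {n : ℕ} {Γ : Ctx S n} {A B : Expr S n} : H n Γ (.tyEq A B) → H n Γ (.tyEq B A)
  ty_trans {n : ℕ} {Γ : Ctx S n} {A B C : Expr S n} :
    H n Γ (.tyEq A B) → H n Γ (.tyEq B C) → H n Γ (.tyEq A C)
  tm_refl {n : ℕ} {Γ : Ctx S n} {a A : Expr S n} : H n Γ (.hasType a A) → H n Γ (.tmEq a a A)
  tm_symm {n : ℕ} {Γ : Ctx S n} {a b A : Expr S n} : H n Γ (.tmEq a b A) → H n Γ (.tmEq b a A)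
  tm_trans {n : ℕ} {Γ : Ctx S n} {a b c A : Expr S n} :
    H n Γ (.tmEq a b A) → H n Γ (.tmEq b c A) → H n Γ (.tmEq a c A)
  tm_conv {n : ℕ} {Γ : Ctx S n} {a A B : Expr S n} :
    H n Γ (.hasType a A) → H n Γ (.tyEq A B) → H n Γ (.hasType a B)
  tmEq_conv {n : ℕ} {Γ : Ctx S n} {a b A B : Expr S n} :
    H n Γ (.tmEq a b A) → H n Γ (.tyEq A B) → H n Γ (.tmEq a b B)
  id_form {n : ℕ} {Γ : Ctx S n} {A a b : Expr S n} :
    H n Γ (.hasType a A) → H n Γ (.hasType b A) → H n Γ (.isType (.Id A a b))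
  id_intro {n : ℕ} {Γ : Ctx S n} {A a : Expr S n} :
    H n Γ (.hasType a A) → H n Γ (.hasType (.refl a) (.Id A a a))
  id_elim {n k : ℕ} {Γ : Ctx S n} {A : Expr S n} {Θ : Tel S (n + 3) k} {C : Expr S (n + 3 + k)}
    {d : Expr S (n + 1 + k)} {a b p : Expr S n} {t : Fin k → Expr S n} :
    H _ ((Γ.idCtx A).append Θ) (.isType C) →
    H _ ((Γ.snoc A).append (Θ.subst (reflSub S n)))
      (.hasType d (C.subst (upN (reflSub S n) k))) →
    IsSub H Γ ((Γ.idCtx A).append Θ) (appendSub (scons p (scons b (scons a var))) t) →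
    H n Γ (.hasType (.J a b p d t) (C.subst (appendSub (scons p (scons b (scons a var))) t)))
  id_comp {n k : ℕ} {Γ : Ctx S n} {A : Expr S n} {Θ : Tel S (n + 3) k} {C : Expr S (n + 3 + k)}
    {d : Expr S (n + 1 + k)} {a : Expr S n} {t : Fin k → Expr S n} :
    H _ ((Γ.idCtx A).append Θ) (.isType C) →
    H _ ((Γ.snoc A).append (Θ.subst (reflSub S n)))
      (.hasType d (C.subst (upN (reflSub S n) k))) →
    IsSub H Γ ((Γ.snoc A).append (Θ.subst (reflSub S n))) (appendSub (scons a var) t) →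
    H n Γ (.tmEq (.J a a (.refl a) d t) (d.subst (appendSub (scons a var) t))
      (C.subst (appendSub (scons (.refl a) (scons a (scons a var))) t)))

namespace DependentTypeTheory

variable (T : DependentTypeTheory.{u})

section Lemmas

variable {T} {l m n : ℕ} {Γ : Ctx T.S m} {Δ : Ctx T.S n} {Ξ : Ctx T.S l}

theorem isSub_comp {σ : Fin m → Expr T.S n} {τ : Fin n → Expr T.S l} (hΞ : WF T.H Ξ)
    (hτ : IsSub T.H Ξ Δ τ) (hσ : IsSub T.H Δ Γ σ) : IsSub T.H Ξ Γ fun i => (σ i).subst τ := by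
  induction Γ with
  | nil => trivial
  | snoc Γ A ih =>
    refine ⟨ih hσ.1, ?_⟩
    have := T.substitution hσ.2 hΞ hτ
    simpa only [Judgement.subst, subst_subst] using this

theorem isSub_wk_comp {σ : Fin m → Expr T.S n} {B : Expr T.S n} (hB : T.H _ Δ (.isType B))
    (hσ : IsSub T.H Δ Γ σ) : IsSub T.H (Δ.snoc B) Γ fun i => (σ i).subst (wk T.S n) := by
  induction Γ with
  | nil => trivial
  | snoc Γ A ih =>
    refine ⟨ih hσ.1, ?_⟩
    have := T.weakening hσ.2 hB
    simpa only [Judgement.subst, subst_subst] using this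

theorem isSub_var (hΓ : WF T.H Γ) : IsSub T.H Γ Γ var := by
  induction Γ with
  | nil => trivial
  | snoc Γ A ih => exact ⟨isSub_wk_comp hΓ.2 (ih hΓ.1), T.assumption hΓ.2⟩

theorem isSub_wk {A : Expr T.S m} (h : WF T.H (Γ.snoc A)) :
    IsSub T.H (Γ.snoc A) Γ (wk T.S m) := (isSub_var h).1

theorem subEq_refl {σ : Fin m → Expr T.S n} (hσ : IsSub T.H Δ Γ σ) : SubEq T.H Δ Γ σ σ := by
  induction Γ with
  | nil => trivial
  | snoc Γ A ih => exact ⟨ih hσ.1, T.tm_refl hσ.2⟩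

theorem subEq_symm {σ τ : Fin m → Expr T.S n} (hΓ : WF T.H Γ) (hΔ : WF T.H Δ)
    (hσ : IsSub T.H Δ Γ σ) (hτ : IsSub T.H Δ Γ τ) (h : SubEq T.H Δ Γ σ τ) :
    SubEq T.H Δ Γ τ σ := by
  induction Γ with
  | nil => trivial
  | snoc Γ A ih =>
    exact ⟨ih hΓ.1 hσ.1 hτ.1 h.1, T.tmEq_conv (T.tm_symm h.2)
      (T.substitution_type_congr hΓ.2 hΔ hσ.1 hτ.1 h.1)⟩

theorem subEq_trans {σ τ υ : Fin m → Expr T.S n} (hΓ : WF T.H Γ) (hΔ : WF T.H Δ)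
    (hσ : IsSub T.H Δ Γ σ) (hτ : IsSub T.H Δ Γ τ)
    (h : SubEq T.H Δ Γ σ τ) (h' : SubEq T.H Δ Γ τ υ) : SubEq T.H Δ Γ σ υ := by
  induction Γ with
  | nil => trivial
  | snoc Γ A ih =>
    exact ⟨ih hΓ.1 hσ.1 hτ.1 h.1 h'.1, T.tm_trans h.2 (T.tmEq_conv h'.2
      (T.ty_symm (T.substitution_type_congr hΓ.2 hΔ hσ.1 hτ.1 h.1)))⟩

theorem subEq_comp_left {σ : Fin m → Expr T.S n} {τ τ' : Fin n → Expr T.S l} (hΞ : WF T.H Ξ)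
    (hσ : IsSub T.H Δ Γ σ) (hτ : IsSub T.H Ξ Δ τ) (hτ' : IsSub T.H Ξ Δ τ')
    (h : SubEq T.H Ξ Δ τ τ') :
    SubEq T.H Ξ Γ (fun i => (σ i).subst τ) (fun i => (σ i).subst τ') := by
  induction Γ with
  | nil => trivial
  | snoc Γ A ih =>
    refine ⟨ih hσ.1, ?_⟩
    have := T.substitution_term_congr hσ.2 hΞ hτ hτ' h
    simpa only [subst_subst] using this

theorem subEq_comp_right {σ σ' : Fin m → Expr T.S n} {τ : Fin n → Expr T.S l} (hΞ : WF T.H Ξ)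
    (hτ : IsSub T.H Ξ Δ τ) (h : SubEq T.H Δ Γ σ σ') :
    SubEq T.H Ξ Γ (fun i => (σ i).subst τ) (fun i => (σ' i).subst τ) := by
  induction Γ with
  | nil => trivial
  | snoc Γ A ih =>
    refine ⟨ih h.1, ?_⟩
    have := T.substitution h.2 hΞ hτ
    simpa only [Judgement.subst, subst_subst] using this

end Lemmas

/-- The contexts of `T`. -/
structure Cxt where
  len : ℕ
  ctx : Ctx T.S len
  wf : WF T.H ctx

variable {T}

/-- Context morphisms, before the identification of definitionally equal ones. -/
def Mor (Δ Γ : T.Cxt) : Type u := {σ : Fin Γ.len → Expr T.S Δ.len // IsSub T.H Δ.ctx Γ.ctx σ}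

def morSetoid (Δ Γ : T.Cxt) : Setoid (Mor Δ Γ) where
  r σ τ := SubEq T.H Δ.ctx Γ.ctx σ.1 τ.1
  iseqv :=
    { refl := fun σ => subEq_refl σ.2
      symm := fun {σ τ} h => subEq_symm Γ.wf Δ.wf σ.2 τ.2 h
      trans := fun {σ τ _} h h' => subEq_trans Γ.wf Δ.wf σ.2 τ.2 h h' }

/-- The classifying category: objects are the well-formed contexts, maps are the context morphisms up
to definitional equality, and composition is substitution. (Definitionally equal contexts are not
identified; they are canonically isomorphic.) -/
instance : Category.{u} T.Cxt where
  Hom Δ Γ := Quotient (morSetoid Δ Γ)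
  id Γ := Quotient.mk _ ⟨var, isSub_var Γ.wf⟩
  comp {Ξ _ _} f g := Quotient.map₂
    (fun (τ : Mor _ _) (σ : Mor _ _) => (⟨fun i => (σ.1 i).subst τ.1, isSub_comp Ξ.wf τ.2 σ.2⟩ : Mor _ _))
    (fun (τ τ' : Mor _ _) hτ (σ σ' : Mor _ _) hσ => subEq_trans (Cxt.wf _) Ξ.wf
      (isSub_comp Ξ.wf τ.2 σ.2) (isSub_comp Ξ.wf τ'.2 σ.2)
      (subEq_comp_left Ξ.wf σ.2 τ.2 τ'.2 hτ) (subEq_comp_right Ξ.wf τ'.2 hσ)) f g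
  id_comp f := by
    induction f using Quotient.inductionOn with | _ σ
    refine congrArg (Quotient.mk _) (Subtype.ext ?_)
    funext i; exact subst_var _
  comp_id f := by
    induction f using Quotient.inductionOn with | _ σ
    rfl
  assoc f g h := by
    induction f using Quotient.inductionOn with | _ σ
    induction g using Quotient.inductionOn with | _ τ
    induction h using Quotient.inductionOn with | _ υ
    refine congrArg (Quotient.mk _) (Subtype.ext ?_)
    funext i; exact (subst_subst _ _ _).symm

end DependentTypeTheory

section Abstract

/-- The structure of a category of contexts: a terminal object (the empty context), types in context,
context extension `(Γ, x ∈ A)` with its display map, and substitution in types. -/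
class ContextCategory (C : Type u) [Category.{u} C] where
  empty : C
  isTerminal : IsTerminal empty
  Ty : C → Type u
  ext {Γ : C} (A : Ty Γ) : C
  proj {Γ : C} (A : Ty Γ) : ext A ⟶ Γ
  sub {Δ Γ : C} (σ : Δ ⟶ Γ) (A : Ty Γ) : Ty Δ
  top {Δ Γ : C} (σ : Δ ⟶ Γ) (A : Ty Γ) : ext (sub σ A) ⟶ ext A
  isPullback {Δ Γ : C} (σ : Δ ⟶ Γ) (A : Ty Γ) :
    IsPullback (top σ A) (proj (sub σ A)) (proj A) σ

open ContextCategory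

variable {C : Type u} [Category.{u} C] [ContextCategory C]

/-- The class of display maps `(Γ, x ∈ A) ⟶ Γ`. -/
inductive Display : MorphismProperty C
  | mk {Γ : C} (A : Ty Γ) : Display (proj A)

/-- Dependent contexts relative to `Γ`; the index is the context obtained by concatenation. -/
inductive DepCxt (Γ : C) : C → Type u
  | nil : DepCxt Γ Γ
  | snoc {Δ : C} (Θ : DepCxt Γ Δ) (A : Ty Δ) : DepCxt Γ (ext A)

namespace DepCxt

/-- The dependent projection `(Γ, Θ) ⟶ Γ`. -/
def proj {Γ : C} : {Δ : C} → DepCxt Γ Δ → (Δ ⟶ Γ)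
  | _, nil => 𝟙 Γ
  | _, snoc Θ A => ContextCategory.proj A ≫ Θ.proj

/-- Concatenation of dependent contexts. -/
def append {Γ Δ : C} (Θ : DepCxt Γ Δ) : {Ξ : C} → DepCxt Δ Ξ → DepCxt Γ Ξ
  | _, nil => Θ
  | _, snoc Ω A => (Θ.append Ω).snoc A

theorem append_proj {Γ Δ Ξ : C} (Θ : DepCxt Γ Δ) (Ω : DepCxt Δ Ξ) :
    (Θ.append Ω).proj = Ω.proj ≫ Θ.proj := by
  induction Ω with
  | nil => simp [append, proj]
  | snoc Ω A ih => simp [append, proj, ih]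

/-- A substitution instance of a dependent context. -/
structure Pulled {Γ Δ Γ' : C} (Θ : DepCxt Γ Δ) (σ : Γ' ⟶ Γ) where
  obj : C
  tel : DepCxt Γ' obj
  top : obj ⟶ Δ
  isPullback : IsPullback top tel.proj Θ.proj σ

/-- Substitution in a dependent context. -/
def pull {Γ Γ' : C} (σ : Γ' ⟶ Γ) : {Δ : C} → (Θ : DepCxt Γ Δ) → Pulled Θ σ
  | _, nil => ⟨Γ', nil, σ, by dsimp only [proj]; exact IsPullback.of_vert_isIso ⟨by simp⟩⟩
  | _, snoc Θ A =>
    { obj := ext (sub (Θ.pull σ).top A)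
      tel := (Θ.pull σ).tel.snoc (sub (Θ.pull σ).top A)
      top := ContextCategory.top (Θ.pull σ).top A
      isPullback := (ContextCategory.isPullback _ A).paste_vert (Θ.pull σ).isPullback }

end DepCxt

/-- Dependent projections (composites of display maps), up to isomorphism. -/
def DepProj : MorphismProperty C := fun X Γ p =>
  ∃ (Δ : C) (Θ : DepCxt Γ Δ) (e : X ≅ Δ), p = e.hom ≫ Θ.proj

theorem DepCxt.depProj {Γ Δ : C} (Θ : DepCxt Γ Δ) : DepProj Θ.proj :=
  ⟨Δ, Θ, Iso.refl _, by simp⟩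

theorem depProj_proj {Γ : C} (A : Ty Γ) : DepProj (proj A) :=
  ⟨_, DepCxt.nil.snoc A, Iso.refl _, by simp [DepCxt.proj]⟩

theorem DepProj.of_isIso {X Y : C} (f : X ⟶ Y) [IsIso f] : DepProj f :=
  ⟨_, .nil, asIso f, by simp [DepCxt.proj]⟩

theorem DepProj.baseChange {X Y X' Y' : C} {p : X ⟶ Y} (hp : DepProj p) {g' : X' ⟶ X}
    {p' : X' ⟶ Y'} {g : Y' ⟶ Y} (h : IsPullback g' p' p g) : DepProj p' := by
  obtain ⟨Δ, Θ, e, rfl⟩ := hp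
  have h2 : IsPullback (g' ≫ e.hom) p' Θ.proj g := by
    have := h.paste_horiz (IsPullback.of_horiz_isIso (fst := e.hom) (snd := e.hom ≫ Θ.proj) (f := Θ.proj) (g := 𝟙 Y) ⟨by simp⟩)
    simpa using this
  exact ⟨_, (Θ.pull g).tel, h2.isoIsPullback _ _ (Θ.pull g).isPullback, by simp⟩

theorem DepProj.exists_pullback {X Y Y' : C} {p : X ⟶ Y} (hp : DepProj p) (g : Y' ⟶ Y) :
    ∃ (X' : C) (g' : X' ⟶ X) (p' : X' ⟶ Y'), IsPullback g' p' p g := by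
  obtain ⟨Δ, Θ, e, rfl⟩ := hp
  refine ⟨_, (Θ.pull g).top ≫ e.inv, (Θ.pull g).tel.proj, ?_⟩
  have := (Θ.pull g).isPullback.paste_horiz (IsPullback.of_horiz_isIso (fst := e.inv) (snd := Θ.proj) (f := e.hom ≫ Θ.proj) (g := 𝟙 Y) ⟨by simp⟩)
  simpa using this

theorem DepProj.comp {X Y Z : C} {p : X ⟶ Y} {q : Y ⟶ Z} (hp : DepProj p) (hq : DepProj q) :
    DepProj (p ≫ q) := by
  obtain ⟨Δ, Θ, e, rfl⟩ := hq
  have : DepProj (p ≫ e.hom) :=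
    hp.baseChange (g := e.inv) (g' := 𝟙 _) (IsPullback.of_horiz_isIso ⟨by simp⟩)
  obtain ⟨Δ', Θ', e', h⟩ := this
  exact ⟨_, Θ.append Θ', e', by rw [DepCxt.append_proj, ← Category.assoc, h, Category.assoc]⟩

theorem llp_depProj {X Y : C} {i : X ⟶ Y} (hi : Display.llp i) : (DepProj (C := C)).llp i := by
  rintro E B _ ⟨Δ, Θ, e, rfl⟩
  have : HasLiftingProperty i Θ.proj := by
    clear e
    induction Θ with
    | nil => simp only [DepCxt.proj]; infer_instance
    | snoc Θ A ih =>
      have := hi _ (Display.mk A)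
      simp only [DepCxt.proj]; infer_instance
  infer_instance

/-- The elimination and computation rules for `i : X ⟶ Y` over `Γ`: after any change of base `σ` of `Γ`
and in the presence of any dependent context of parameters over `Y`, the map `i` has the left lifting
property with respect to display maps. -/
def StableElim {X Y Γ : C} (π : Y ⟶ Γ) (i : X ⟶ Y) : Prop :=
  ∀ ⦃Γ' Y' Z W : C⦄ (σ : Γ' ⟶ Γ) (q : Y' ⟶ Y) (π' : Y' ⟶ Γ'), IsPullback q π' π σ →
    ∀ p : Z ⟶ Y', DepProj p → ∀ (i' : W ⟶ Z) (p' : W ⟶ X), IsPullback i' p' (p ≫ q) i →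
      Display.llp i'

namespace StableElim

theorem lift {X Y Γ Z W : C} {π : Y ⟶ Γ} {i : X ⟶ Y} (hi : StableElim π i) {p : Z ⟶ Y}
    (hp : DepProj p) {i' : W ⟶ Z} {p' : W ⟶ X} (h : IsPullback i' p' p i) :
    (DepProj (C := C)).llp i' :=
  llp_depProj (hi (𝟙 Γ) (𝟙 Y) π (IsPullback.of_horiz_isIso ⟨by simp⟩) p hp i' p' (by simpa using h))

theorem of_isIso {X Y Γ : C} (π : Y ⟶ Γ) (i : X ⟶ Y) [IsIso i] : StableElim π i := by
  intro _ _ _ _ _ _ _ _ p _ i' p' h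
  have := h.isIso_fst_of_isIso
  exact MorphismProperty.llp_of_isIso _ _

theorem comp {X M Y Γ : C} {i : X ⟶ M} {j : M ⟶ Y} {π : Y ⟶ Γ} (hi : StableElim (j ≫ π) i)
    (hj : StableElim π j) (hM : DepProj (j ≫ π)) : StableElim π (i ≫ j) := by
  intro Γ' Y' Z W σ q π' hq p hp i' p' h
  obtain ⟨M', qm, πm, hm⟩ := hM.exists_pullback σ
  let j' : M' ⟶ Y' := hq.lift (qm ≫ j) πm (by simpa using hm.w)
  have hj' : IsPullback j' qm q j := by
    refine (IsPullback.of_bot (h₁₁ := qm) (v₁₁ := j') (v₂₁ := π') (by simpa [j'] using hm) (by simp [j']) hq).flip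
  obtain ⟨V, g, v, hV⟩ := hp.exists_pullback j'
  have hV2 : IsPullback g (v ≫ qm) (p ≫ q) j := hV.paste_vert hj'
  let w : W ⟶ V := hV2.lift i' (p' ≫ i) (by simpa using h.w)
  have hw : IsPullback w p' (v ≫ qm) i := IsPullback.of_right (h₁₂ := g) (by simpa [w] using h) (by simp [w]) hV2
  have e : i' = w ≫ g := by simp [w]
  rw [e]
  exact Display.llp.comp_mem _ _ (hi σ qm πm hm v (hp.baseChange hV) w p' hw)
    (hj σ q π' hq p hp g _ hV2)

theorem baseChange {X Y Q W Γ : C} {i : X ⟶ Y} {π : Y ⟶ Γ} (hi : StableElim π i)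
    (hπ : DepProj π) {c : Q ⟶ Y} (hc : DepProj c) {i₁ : W ⟶ Q} {c₁ : W ⟶ X}
    (h₁ : IsPullback i₁ c₁ c i) : StableElim (c ≫ π) i₁ := by
  intro Γ' Q' Z V σ q π' hq p hp i' p' h
  obtain ⟨Y', qy, πy, hy⟩ := hπ.exists_pullback σ
  let c' : Q' ⟶ Y' := hy.lift (q ≫ c) π' (by simpa using hq.w)
  have hc' : IsPullback q c' c qy :=
    IsPullback.of_bot (by simpa [c'] using hq) (by simp [c']) hy
  refine hi σ qy πy hy (p ≫ c') (hp.comp (hc.baseChange hc')) i' (p' ≫ c₁) ?_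
  have := h.paste_vert h₁
  rw [Category.assoc, ← hc'.w, ← Category.assoc]
  exact this

theorem of_comp {X Y Γ Γ₀ : C} {i : X ⟶ Y} {π : Y ⟶ Γ} (hi : StableElim π i) {ρ : Γ ⟶ Γ₀}
    (hρ : DepProj ρ) : StableElim (π ≫ ρ) i := by
  intro Γ' Y' Z V σ q π' hq
  obtain ⟨Γ'', s, r, hs⟩ := hρ.exists_pullback σ
  refine hi s q (hs.lift (q ≫ π) π' (by simpa using hq.w)) ?_
  exact IsPullback.of_bot (by simpa using hq) (by simp) hs

end StableElim

/-- Identity types in a category of contexts: `dbl A` is the context `(Γ, x ∈ A, y ∈ A)`, with `x` and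
`y` given by its display map and by `dblTop`; `Id A` is the type `Id_A(x, y)` over it, and `refl A` is
`(x, x, r(x))`. -/
class IdentityTypes (C : Type u) [Category.{u} C] [ContextCategory C] where
  dbl {Γ : C} (A : Ty Γ) : Ty (ext A)
  dblTop {Γ : C} (A : Ty Γ) : ext (dbl A) ⟶ ext A
  dbl_isPullback {Γ : C} (A : Ty Γ) :
    IsPullback (dblTop A) (proj (dbl A)) (proj A) (proj A)
  Id {Γ : C} (A : Ty Γ) : Ty (ext (dbl A))
  refl {Γ : C} (A : Ty Γ) : ext A ⟶ ext (Id A)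
  refl_fst {Γ : C} (A : Ty Γ) : refl A ≫ proj (Id A) ≫ proj (dbl A) = 𝟙 _
  refl_snd {Γ : C} (A : Ty Γ) : refl A ≫ proj (Id A) ≫ dblTop A = 𝟙 _
  elim {Γ : C} (A : Ty Γ) : StableElim (proj (Id A) ≫ proj (dbl A) ≫ proj A) (refl A)

open IdentityTypes

namespace DepCxt

variable {Γ Δ : C} (Θ : DepCxt Γ Δ)

/-- `(Γ, x ∈ Θ, y ∈ Θ)`. -/
def sq : C := (Θ.pull Θ.proj).obj
/-- `x` -/
def fst : Θ.sq ⟶ Δ := (Θ.pull Θ.proj).tel.proj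
/-- `y` -/
def snd : Θ.sq ⟶ Δ := (Θ.pull Θ.proj).top
theorem isPullback_sq : IsPullback Θ.snd Θ.fst Θ.proj Θ.proj := (Θ.pull Θ.proj).isPullback

end DepCxt

/-- An identity context for a dependent context `Θ`: a dependent context over `(Γ, x ∈ Θ, y ∈ Θ)` with a
reflexivity map, satisfying the introduction, elimination and computation rules. -/
structure IdCxt {Γ Δ : C} (Θ : DepCxt Γ Δ) where
  obj : C
  tel : DepCxt Θ.sq obj
  refl : Δ ⟶ obj
  refl_fst : refl ≫ tel.proj ≫ Θ.fst = 𝟙 Δ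
  refl_snd : refl ≫ tel.proj ≫ Θ.snd = 𝟙 Δ
  elim : StableElim (tel.proj ≫ Θ.fst ≫ Θ.proj) refl

namespace IdCxt

variable {Γ Δ : C} {Θ : DepCxt Γ Δ} (I : IdCxt Θ)

/-- The projection `(x, y, u) ↦ x`. -/
def src : I.obj ⟶ Δ := I.tel.proj ≫ Θ.fst
/-- The projection `(x, y, u) ↦ y`. -/
def tgt : I.obj ⟶ Δ := I.tel.proj ≫ Θ.snd

@[simp] theorem refl_src : I.refl ≫ I.src = 𝟙 Δ := I.refl_fst
@[simp] theorem refl_tgt : I.refl ≫ I.tgt = 𝟙 Δ := I.refl_snd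

@[simp] theorem refl_src_assoc {Z : C} (h : Δ ⟶ Z) : I.refl ≫ I.src ≫ h = h := by
  rw [← Category.assoc, refl_src, Category.id_comp]
@[simp] theorem refl_tgt_assoc {Z : C} (h : Δ ⟶ Z) : I.refl ≫ I.tgt ≫ h = h := by
  rw [← Category.assoc, refl_tgt, Category.id_comp]

theorem src_proj : I.src ≫ Θ.proj = I.tgt ≫ Θ.proj := by
  simp [src, tgt, Θ.isPullback_sq.w]

/-- `(x, z) ↦ (x, x, r(x), z)`  -/
noncomputable def reflParam (A : Ty Δ) : ext A ⟶ ext (sub I.src A) :=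
  (ContextCategory.isPullback I.src A).lift (𝟙 _) (proj A ≫ I.refl) (by simp)

theorem reflParam_isPullback (A : Ty Δ) :
    IsPullback (I.reflParam A) (proj A) (proj (sub I.src A)) I.refl :=
  IsPullback.of_right (by simpa [reflParam] using IsPullback.of_horiz_isIso ⟨by simp⟩)
    (by simp [reflParam]) (ContextCategory.isPullback I.src A)

theorem exists_transport (A : Ty Δ) : ∃ τ : ext (sub I.src A) ⟶ ext A,
    τ ≫ proj A = proj (sub I.src A) ≫ I.tgt ∧ I.reflParam A ≫ τ = 𝟙 _ := by
  have := I.elim.lift (depProj_proj _) (I.reflParam_isPullback A) _ (depProj_proj A)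
  have sq : CommSq (𝟙 _) (I.reflParam A) (proj A) (proj (sub I.src A) ≫ I.tgt) :=
    ⟨by simp [reflParam]⟩
  exact ⟨sq.lift, sq.fac_right, sq.fac_left⟩

/-- A Leibniz rule `(x, y, u, z) ↦ (y, u_!(z))`, given by elimination, with `r(x)_!(z) = z`. -/
noncomputable def transport (A : Ty Δ) : ext (sub I.src A) ⟶ ext A := (I.exists_transport A).choose

@[simp] theorem transport_proj (A : Ty Δ) : I.transport A ≫ proj A = proj (sub I.src A) ≫ I.tgt :=
  (I.exists_transport A).choose_spec.1
@[simp] theorem refl_transport (A : Ty Δ) : I.reflParam A ≫ I.transport A = 𝟙 _ :=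
  (I.exists_transport A).choose_spec.2

/-- The identity context of the empty context. -/
def nil (Γ : C) : IdCxt (DepCxt.nil : DepCxt Γ Γ) where
  obj := Γ
  tel := DepCxt.nil
  refl := 𝟙 Γ
  refl_fst := (Category.id_comp _).trans (Category.id_comp (𝟙 Γ))
  refl_snd := (Category.id_comp _).trans (Category.id_comp (𝟙 Γ))
  elim := StableElim.of_isIso _ _

section Snoc

variable [IdentityTypes C] (A : Ty Δ)

/-- `(x, z, y, w) ↦ (x, y)` -/
noncomputable def sqProj : (Θ.snoc A).sq ⟶ Θ.sq :=
  Θ.isPullback_sq.lift ((Θ.snoc A).snd ≫ proj A) ((Θ.snoc A).fst ≫ proj A)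
    (by simpa [DepCxt.proj] using (Θ.snoc A).isPullback_sq.w)

/-- `(x, z, y, w, u)` -/
noncomputable def base : DepCxt.Pulled I.tel (sqProj (Θ := Θ) A) := I.tel.pull _

/-- `(u, z)` -/
noncomputable def baseParam : (I.base A).obj ⟶ ext (sub I.src A) :=
  (ContextCategory.isPullback I.src A).lift ((I.base A).tel.proj ≫ (Θ.snoc A).fst) (I.base A).top (by
    have := (I.base A).isPullback.w
    simp [src, reassoc_of% this, sqProj])

/-- `(u_! z, w)` -/
noncomputable def ends : (I.base A).obj ⟶ ext (dbl A) :=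
  (dbl_isPullback A).lift ((I.base A).tel.proj ≫ (Θ.snoc A).snd) (I.baseParam A ≫ I.transport A) (by
    have := (I.base A).isPullback.w
    simp [baseParam, tgt, reassoc_of% this, sqProj])

@[simp] theorem sqProj_fst : sqProj (Θ := Θ) A ≫ Θ.fst = (Θ.snoc A).fst ≫ proj A := by simp [sqProj]
@[simp] theorem sqProj_snd : sqProj (Θ := Θ) A ≫ Θ.snd = (Θ.snoc A).snd ≫ proj A := by simp [sqProj]

theorem depProj_sqProj : DepProj (sqProj (Θ := Θ) A) := by
  let N := Θ.pull (Θ.snoc A).proj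
  let n : N.obj ⟶ Θ.sq := Θ.isPullback_sq.lift N.top (N.tel.proj ≫ proj A) (by
    simpa [DepCxt.proj] using N.isPullback.w)
  have hn : IsPullback n N.tel.proj Θ.fst (proj A) :=
    IsPullback.of_right (by simpa [n, DepCxt.proj] using N.isPullback) (by simp [n])
      Θ.isPullback_sq
  have h : sqProj (Θ := Θ) A = proj (sub N.top A) ≫ n := by
    apply Θ.isPullback_sq.hom_ext
    · exact (sqProj_snd A).trans ((ContextCategory.isPullback N.top A).w.trans
        ((congrArg (_ ≫ ·) (Θ.isPullback_sq.lift_fst _ _ _).symm).trans (Category.assoc _ _ _).symm))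
    · exact (sqProj_fst A).trans ((Category.assoc _ _ _).trans
        ((congrArg (_ ≫ ·) (Θ.isPullback_sq.lift_snd _ _ _).symm).trans (Category.assoc _ _ _).symm))
  rw [h]
  exact (depProj_proj _).comp ((depProj_proj A).baseChange hn.flip)

/-- `(x, z, w) ↦ (x, z, x, w)` -/
noncomputable def dblSq : ext (dbl A) ⟶ (Θ.snoc A).sq :=
  (Θ.snoc A).isPullback_sq.lift (dblTop A) (proj (dbl A)) (by
    simp [DepCxt.proj, reassoc_of% (dbl_isPullback A).w])

@[simp] theorem dblSq_fst : dblSq (Θ := Θ) A ≫ (Θ.snoc A).fst = proj (dbl A) :=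
  IsPullback.lift_snd _ _ _ _
@[simp] theorem dblSq_snd : dblSq (Θ := Θ) A ≫ (Θ.snoc A).snd = dblTop A :=
  IsPullback.lift_fst _ _ _ _

theorem dblSq_isPullback : IsPullback (dblSq (Θ := Θ) A) (proj (dbl A) ≫ proj A) (sqProj A)
    (I.refl ≫ I.tel.proj) := by
  have h1 : I.refl ≫ I.tel.proj ≫ Θ.fst = 𝟙 _ := I.refl_fst
  have h2 : I.refl ≫ I.tel.proj ≫ Θ.snd = 𝟙 _ := I.refl_snd
  refine IsPullback.mk' ?_ ?_ ?_
  · apply Θ.isPullback_sq.hom_ext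
    · simp only [Category.assoc, sqProj_snd, h2, Category.comp_id]
      simp [reassoc_of% dblSq_snd, (dbl_isPullback A).w]
    · simp only [Category.assoc, sqProj_fst, h1, Category.comp_id]
      simp [reassoc_of% dblSq_fst]
  · intro T φ φ' h _
    apply (dbl_isPullback A).hom_ext
    · simpa using congrArg (· ≫ (Θ.snoc A).snd) h
    · simpa using congrArg (· ≫ (Θ.snoc A).fst) h
  · intro T a b h
    have e1 : a ≫ (Θ.snoc A).fst ≫ proj A = b := by
      simpa [h1] using congrArg (· ≫ Θ.fst) h
    have e2 : a ≫ (Θ.snoc A).snd ≫ proj A = b := by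
      simpa [h2] using congrArg (· ≫ Θ.snd) h
    refine ⟨(dbl_isPullback A).lift (a ≫ (Θ.snoc A).snd) (a ≫ (Θ.snoc A).fst)
      (by simp [e1, e2]), ?_, by simp [e1]⟩
    apply (Θ.snoc A).isPullback_sq.hom_ext <;> simp

@[simp] theorem base_top_src : (I.base A).top ≫ I.src = (I.base A).tel.proj ≫ (Θ.snoc A).fst ≫ proj A := by
  simp [src, reassoc_of% (I.base A).isPullback.w]

@[simp] theorem baseParam_top : I.baseParam A ≫ top I.src A = (I.base A).tel.proj ≫ (Θ.snoc A).fst := by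
  simp [baseParam]
@[simp] theorem baseParam_proj : I.baseParam A ≫ proj (sub I.src A) = (I.base A).top := by
  simp [baseParam]
@[simp] theorem ends_top : I.ends A ≫ dblTop A = (I.base A).tel.proj ≫ (Θ.snoc A).snd := by simp [ends]
@[simp] theorem ends_proj : I.ends A ≫ proj (dbl A) = I.baseParam A ≫ I.transport A := by simp [ends]

noncomputable def reflBase : ext (dbl A) ⟶ (I.base A).obj :=
  (I.base A).isPullback.lift ((proj (dbl A) ≫ proj A) ≫ I.refl) (dblSq A)
    (by simpa using (I.dblSq_isPullback A).w.symm)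

@[simp] theorem reflBase_top :
    I.reflBase A ≫ (I.base A).top = proj (dbl A) ≫ proj A ≫ I.refl := by simp [reflBase]
@[simp] theorem reflBase_proj : I.reflBase A ≫ (I.base A).tel.proj = dblSq A := by simp [reflBase]

theorem reflBase_isPullback : IsPullback (I.reflBase A) (proj (dbl A) ≫ proj A) (I.base A).top I.refl :=
  IsPullback.of_right (by simpa using I.dblSq_isPullback A) (by simp) (I.base A).isPullback.flip

theorem reflBase_ends : I.reflBase A ≫ I.ends A = 𝟙 _ := by
  have : I.reflBase A ≫ I.baseParam A = proj (dbl A) ≫ I.reflParam A := by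
    apply (ContextCategory.isPullback I.src A).hom_ext
    · simp [reflParam, reassoc_of% (I.reflBase_proj A)]
    · simp [reflParam]
  apply (dbl_isPullback A).hom_ext
  · simp [reassoc_of% (I.reflBase_proj A)]
  · simp [reassoc_of% this]

noncomputable def reflEnds : ext (Id A) ⟶ ext (sub (I.ends A) (Id A)) :=
  (ContextCategory.isPullback (I.ends A) (Id A)).lift (𝟙 _) (proj (Id A) ≫ I.reflBase A)
    (by simp [reflBase_ends])

@[simp] theorem reflEnds_proj :
    I.reflEnds A ≫ proj (sub (I.ends A) (Id A)) = proj (Id A) ≫ I.reflBase A := by simp [reflEnds]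

theorem reflEnds_isPullback : IsPullback (I.reflEnds A) (proj (Id A))
    (proj (sub (I.ends A) (Id A))) (I.reflBase A) :=
  IsPullback.of_right (by simpa [reflEnds, reflBase_ends] using IsPullback.of_horiz_isIso ⟨by simp⟩)
    (by simp) (ContextCategory.isPullback (I.ends A) (Id A))

/-- The identity context of `(x ∈ Θ, z ∈ A(x))`: the variables `u ∈ Id_Θ(x, y)` and
`v ∈ Id_{A(y)}(u_!(z), w)`. -/
noncomputable def snoc : IdCxt (Θ.snoc A) where
  obj := ext (sub (I.ends A) (Id A))
  tel := (I.base A).tel.snoc (sub (I.ends A) (Id A))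
  refl := IdentityTypes.refl A ≫ I.reflEnds A
  refl_fst := by
    simp [DepCxt.proj, reassoc_of% (I.reflEnds_proj A), reassoc_of% (I.reflBase_proj A),
      IdentityTypes.refl_fst]
  refl_snd := by
    simp [DepCxt.proj, reassoc_of% (I.reflEnds_proj A), reassoc_of% (I.reflBase_proj A),
      IdentityTypes.refl_snd]
  elim := by
    have hΘ : DepProj (I.tel.proj ≫ Θ.fst ≫ Θ.proj) :=
      I.tel.depProj.comp ((Θ.pull Θ.proj).tel.depProj.comp Θ.depProj)
    have hb : DepProj (I.base A).top := (depProj_sqProj A).baseChange (I.base A).isPullback.flip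
    have hc : DepProj (proj (sub (I.ends A) (Id A)) ≫ (I.base A).top) := (depProj_proj _).comp hb
    have hg := I.elim.baseChange hΘ hc
      ((I.reflEnds_isPullback A).paste_vert (I.reflBase_isPullback A))
    have hr := (IdentityTypes.elim A).of_comp Θ.depProj
    have e1 : ((I.base A).tel.snoc (sub (I.ends A) (Id A))).proj ≫ (Θ.snoc A).fst ≫
        (Θ.snoc A).proj = (proj (sub (I.ends A) (Id A)) ≫ (I.base A).top) ≫
          I.tel.proj ≫ Θ.fst ≫ Θ.proj := by
      have := congrArg (· ≫ Θ.proj) (I.base_top_src A)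
      simp only [src, Category.assoc] at this
      simp [DepCxt.proj, this]
    rw [e1]
    have h1 : I.refl ≫ I.tel.proj ≫ Θ.fst ≫ Θ.proj = Θ.proj := by
      have := I.refl_src_assoc Θ.proj
      simpa [src] using this
    have e2 : I.reflEnds A ≫ (proj (sub (I.ends A) (Id A)) ≫ (I.base A).top) ≫
        I.tel.proj ≫ Θ.fst ≫ Θ.proj = (proj (Id A) ≫ proj (dbl A) ≫ proj A) ≫ Θ.proj := by
      simp [reassoc_of% (I.reflEnds_proj A), reassoc_of% (I.reflBase_top A), h1]
    refine StableElim.comp (e2 ▸ hr) hg (e2 ▸ ?_)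
    exact ((depProj_proj _).comp ((depProj_proj _).comp (depProj_proj _))).comp Θ.depProj

end Snoc

/-- The identity context of a dependent context, by induction on its length. -/
noncomputable def of [IdentityTypes C] : {Δ : C} → (Θ : DepCxt Γ Δ) → IdCxt Θ
  | _, .nil => nil Γ
  | _, .snoc Θ A => (of Θ).snoc A

theorem depProj_src : DepProj I.src := I.tel.depProj.comp (Θ.pull Θ.proj).tel.depProj
theorem depProj_tgt : DepProj I.tgt := I.tel.depProj.comp (Θ.depProj.baseChange Θ.isPullback_sq.flip)

theorem tel_ext {Z : C} {p q : Z ⟶ I.obj} (h : p ≫ I.src = q ≫ I.src)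
    (h' : p ≫ I.tgt = q ≫ I.tgt) : p ≫ I.tel.proj = q ≫ I.tel.proj :=
  Θ.isPullback_sq.hom_ext (by simpa [tgt] using h') (by simpa [src] using h)

/-- `p` and `q` are propositionally equal. -/
def Joined {Z : C} (p q : Z ⟶ Δ) : Prop := ∃ h : Z ⟶ I.obj, h ≫ I.src = p ∧ h ≫ I.tgt = q

theorem Joined.precomp {I : IdCxt Θ} {Z Z' : C} {p q : Z ⟶ Δ} (h : I.Joined p q) (s : Z' ⟶ Z) :
    I.Joined (s ≫ p) (s ≫ q) := by
  obtain ⟨h, rfl, rfl⟩ := h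
  exact ⟨s ≫ h, by simp, by simp⟩

theorem joined_refl {Z : C} (p : Z ⟶ Δ) : I.Joined p p := ⟨p ≫ I.refl, by simp, by simp⟩

theorem exists_lift {Z W E B : C} {z : Z ⟶ I.obj} (hz : DepProj z) {i' : W ⟶ Z} {p' : W ⟶ Δ}
    (h : IsPullback i' p' z I.refl) {e : E ⟶ B} (he : DepProj e) (t : W ⟶ E) (b : Z ⟶ B)
    (w : t ≫ e = i' ≫ b) : ∃ l : Z ⟶ E, i' ≫ l = t ∧ l ≫ e = b := by
  have := I.elim.lift hz h _ he
  have sq : CommSq t i' e b := ⟨w⟩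
  exact ⟨sq.lift, sq.fac_left, sq.fac_right⟩

theorem exists_path {Γ' Δ' : C} {Ω : DepCxt Γ' Δ'} (K : IdCxt Ω) {Z W : C} {z : Z ⟶ K.obj}
    (hz : DepProj z) {i' : W ⟶ Z} {p' : W ⟶ Δ'} (h : IsPullback i' p' z K.refl)
    (t : W ⟶ I.obj) (x y : Z ⟶ Δ) (hxy : x ≫ Θ.proj = y ≫ Θ.proj)
    (hx : t ≫ I.src = i' ≫ x) (hy : t ≫ I.tgt = i' ≫ y) :
    ∃ l : Z ⟶ I.obj, i' ≫ l = t ∧ l ≫ I.src = x ∧ l ≫ I.tgt = y := by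
  obtain ⟨l, h, h'⟩ := K.exists_lift hz h I.tel.depProj t (Θ.isPullback_sq.lift y x hxy.symm) (by
    apply Θ.isPullback_sq.hom_ext
    · simpa [tgt] using hy
    · simpa [src] using hx)
  exact ⟨l, h, by simp [src, reassoc_of% h'], by simp [tgt, reassoc_of% h']⟩

theorem joined_of_elim {Γ' Δ' : C} {Ω : DepCxt Γ' Δ'} (K : IdCxt Ω) {Z : C} {z : Z ⟶ K.obj}
    (hz : DepProj z) {p q : Z ⟶ Δ} (hpq : p ≫ Θ.proj = q ≫ Θ.proj)
    (H : ∀ ⦃W : C⦄ (i' : W ⟶ Z) (p' : W ⟶ Δ'), i' ≫ z = p' ≫ K.refl → i' ≫ p = i' ≫ q) :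
    I.Joined p q := by
  obtain ⟨W, p', i', h⟩ := hz.exists_pullback K.refl
  have e := H p' i' h.w
  obtain ⟨l, -, hl⟩ := I.exists_path K hz h (p' ≫ p ≫ I.refl) p q hpq (by simp) (by simp [e])
  exact ⟨l, hl⟩

theorem refl_isPullback : IsPullback I.refl (𝟙 _) (𝟙 _) I.refl := IsPullback.of_vert_isIso ⟨by simp⟩

theorem exists_inverse : ∃ v : I.obj ⟶ I.obj,
    v ≫ I.src = I.tgt ∧ v ≫ I.tgt = I.src ∧ I.refl ≫ v = I.refl := by
  obtain ⟨l, h, h1, h2⟩ := I.exists_path I (DepProj.of_isIso (𝟙 _)) I.refl_isPullback I.refl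
    I.tgt I.src I.src_proj.symm (by simp) (by simp)
  exact ⟨l, h1, h2, h⟩

/-- An inverse operation on paths given by elimination. -/
noncomputable def inverse : I.obj ⟶ I.obj := I.exists_inverse.choose
@[simp] theorem inverse_src : I.inverse ≫ I.src = I.tgt := I.exists_inverse.choose_spec.1
@[simp] theorem inverse_tgt : I.inverse ≫ I.tgt = I.src := I.exists_inverse.choose_spec.2.1
@[simp] theorem refl_inverse : I.refl ≫ I.inverse = I.refl := I.exists_inverse.choose_spec.2.2

/-- A composition operation on paths, stable under substitution (`op p q` is the path `p` followed by
the path `q`). -/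
structure Composition where
  op {Z : C} (p q : Z ⟶ I.obj) (h : p ≫ I.tgt = q ≫ I.src) : Z ⟶ I.obj
  op_src {Z : C} (p q : Z ⟶ I.obj) (h : p ≫ I.tgt = q ≫ I.src) : op p q h ≫ I.src = p ≫ I.src
  op_tgt {Z : C} (p q : Z ⟶ I.obj) (h : p ≫ I.tgt = q ≫ I.src) : op p q h ≫ I.tgt = q ≫ I.tgt
  precomp {Z Z' : C} (s : Z' ⟶ Z) (p q : Z ⟶ I.obj) (h : p ≫ I.tgt = q ≫ I.src) :
    s ≫ op p q h = op (s ≫ p) (s ≫ q) (by simp [h])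
  op_refl {Z : C} (p : Z ⟶ I.obj) (x : Z ⟶ Δ) (h : p ≫ I.tgt = (x ≫ I.refl) ≫ I.src) :
    op p (x ≫ I.refl) h = p

theorem nonempty_composition : Nonempty I.Composition := by
  obtain ⟨K, a, b, hK⟩ := I.depProj_tgt.exists_pullback I.src
  let i' : I.obj ⟶ K := hK.lift (𝟙 _) (I.tgt ≫ I.refl) (by simp)
  have hi : IsPullback i' I.tgt b I.refl :=
    IsPullback.of_right (by simpa [i'] using IsPullback.of_horiz_isIso ⟨by simp⟩) (by simp [i']) hK
  have e : a ≫ I.src ≫ Θ.proj = b ≫ I.tgt ≫ Θ.proj := by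
    rw [I.src_proj, ← I.src_proj, I.src_proj, ← Category.assoc, hK.w, Category.assoc, I.src_proj]
  obtain ⟨l, h, h1, h2⟩ := I.exists_path I (I.depProj_tgt.baseChange hK) hi (𝟙 _)
    (a ≫ I.src) (b ≫ I.tgt) (by simpa using e) (by simp [i']) (by simp [i'])
  refine ⟨{ op := fun p q h => hK.lift p q h ≫ l, op_src := ?_, op_tgt := ?_, precomp := ?_, op_refl := ?_}⟩
  · intro Z p q h; simp [h1]
  · intro Z p q h; simp [h2]
  · intro Z Z' s p q h
    rw [← Category.assoc]
    congr 1
    apply hK.hom_ext <;> simp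
  · intro Z p x e
    have : hK.lift p (x ≫ I.refl) e = p ≫ i' := by
      apply hK.hom_ext
      · simp [i']
      · have e' : p ≫ I.tgt = x := by simpa using e
        simp [i', reassoc_of% e']
    rw [this, Category.assoc, h, Category.comp_id]

noncomputable def composition : I.Composition := I.nonempty_composition.some

theorem joined_symm {Z : C} {p q : Z ⟶ Δ} (h : I.Joined p q) : I.Joined q p := by
  obtain ⟨h, rfl, rfl⟩ := h
  exact ⟨h ≫ I.inverse, by simp, by simp⟩

theorem joined_trans {Z : C} {p q r : Z ⟶ Δ} (h : I.Joined p q) (h' : I.Joined q r) :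
    I.Joined p r := by
  obtain ⟨h, rfl, rfl⟩ := h
  obtain ⟨h', e, rfl⟩ := h'
  exact ⟨I.composition.op h h' e.symm, I.composition.op_src _ _ _, I.composition.op_tgt _ _ _⟩

end IdCxt

/-- Every object is a context, built from the empty context. -/
class Contextual (C : Type u) [Category.{u} C] [ContextCategory C] where
  cxt (Φ : C) : DepCxt (empty : C) Φ

section Groupoid

variable [IdentityTypes C] [Contextual C]

/-- `(x ∈ Φ, y ∈ Φ, u ∈ Id_Φ(x, y))`. -/
noncomputable def pathCxt (Φ : C) : IdCxt (Contextual.cxt Φ) := IdCxt.of _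

/-- The identity context of the dependent context `Id_Φ(x, y)` over `(x ∈ Φ, y ∈ Φ)`. -/
noncomputable def homotopyCxt (Φ : C) : IdCxt (pathCxt Φ).tel := IdCxt.of _

theorem joined_of_elim {Φ Γ' Δ' : C} {Ω : DepCxt Γ' Δ'} (K : IdCxt Ω) {Z : C} {z : Z ⟶ K.obj}
    (hz : DepProj z) {p q : Z ⟶ (pathCxt Φ).obj} (hs : p ≫ (pathCxt Φ).src = q ≫ (pathCxt Φ).src)
    (ht : p ≫ (pathCxt Φ).tgt = q ≫ (pathCxt Φ).tgt)
    (H : ∀ ⦃W : C⦄ (i' : W ⟶ Z) (p' : W ⟶ Δ'), i' ≫ z = p' ≫ K.refl → i' ≫ p = i' ≫ q) :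
    (homotopyCxt Φ).Joined p q :=
  (homotopyCxt Φ).joined_of_elim K hz ((pathCxt Φ).tel_ext hs ht) H

/-- The fundamental groupoid of a context. Its objects are the global elements `( ) ⟶ Φ`. -/
@[ext] structure FundamentalGroupoid (Φ : C) : Type u where
  pt : (empty : C) ⟶ Φ

namespace FundamentalGroupoid

/-- Paths `p ∈ Id_Φ(a, b)`. -/
def Path {Φ : C} (a b : FundamentalGroupoid Φ) : Type u :=
  {p : (empty : C) ⟶ (pathCxt Φ).obj // p ≫ (pathCxt Φ).src = a.pt ∧ p ≫ (pathCxt Φ).tgt = b.pt}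

/-- Homotopy of paths: propositional equality in `Id_Φ(a, b)`. -/
def homotopySetoid {Φ : C} (a b : FundamentalGroupoid Φ) : Setoid (Path a b) where
  r p q := (homotopyCxt Φ).Joined p.1 q.1
  iseqv := ⟨fun p => (homotopyCxt Φ).joined_refl p.1, (homotopyCxt Φ).joined_symm,
    (homotopyCxt Φ).joined_trans⟩

variable {Φ : C}

theorem homotopy_src :
    (homotopyCxt Φ).src ≫ (pathCxt Φ).src = (homotopyCxt Φ).tgt ≫ (pathCxt Φ).src := by
  simpa [IdCxt.src] using congrArg (· ≫ DepCxt.fst _) (homotopyCxt Φ).src_proj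

theorem homotopy_tgt :
    (homotopyCxt Φ).src ≫ (pathCxt Φ).tgt = (homotopyCxt Φ).tgt ≫ (pathCxt Φ).tgt := by
  simpa [IdCxt.tgt] using congrArg (· ≫ DepCxt.snd _) (homotopyCxt Φ).src_proj

/-- Concatenation of paths respects homotopies. -/
theorem joined_op {Z : C} {p p' q q' : Z ⟶ (pathCxt Φ).obj} (hp : (homotopyCxt Φ).Joined p p')
    (hq : (homotopyCxt Φ).Joined q q') (h : p ≫ (pathCxt Φ).tgt = q ≫ (pathCxt Φ).src)
    (h' : p' ≫ (pathCxt Φ).tgt = q' ≫ (pathCxt Φ).src) :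
    (homotopyCxt Φ).Joined ((pathCxt Φ).composition.op p q h)
      ((pathCxt Φ).composition.op p' q' h') := by
  obtain ⟨u, rfl, rfl⟩ := hp
  obtain ⟨v, rfl, rfl⟩ := hq
  have e : u ≫ (homotopyCxt Φ).tgt ≫ (pathCxt Φ).tgt =
      (v ≫ (homotopyCxt Φ).src) ≫ (pathCxt Φ).src := by
    simpa [homotopy_tgt] using h
  refine (homotopyCxt Φ).joined_trans (q := (pathCxt Φ).composition.op
    (u ≫ (homotopyCxt Φ).tgt) (v ≫ (homotopyCxt Φ).src) (by simpa using e)) ?_ ?_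
  · obtain ⟨L, a, b, hL⟩ := (pathCxt Φ).depProj_src.exists_pullback
      ((homotopyCxt Φ).tgt ≫ (pathCxt Φ).tgt)
    have hb : DepProj b := (pathCxt Φ).depProj_src.baseChange hL
    have key : (homotopyCxt Φ).Joined
        ((pathCxt Φ).composition.op (b ≫ (homotopyCxt Φ).src) a (by simp [hL.w, homotopy_tgt]))
        ((pathCxt Φ).composition.op (b ≫ (homotopyCxt Φ).tgt) a (by simp [hL.w])) := by
      refine joined_of_elim _ hb ?_ ?_ ?_
      · simp [IdCxt.Composition.op_src, homotopy_src]
      · simp [IdCxt.Composition.op_tgt]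
      · intro W i' p' hw
        rw [IdCxt.Composition.precomp, IdCxt.Composition.precomp]
        congr 1
        simp [reassoc_of% hw]
    have := key.precomp (hL.lift (v ≫ (homotopyCxt Φ).src) u (by simpa using e.symm))
    simpa [IdCxt.Composition.precomp] using this
  · obtain ⟨L, a, b, hL⟩ := (pathCxt Φ).depProj_tgt.exists_pullback
      ((homotopyCxt Φ).src ≫ (pathCxt Φ).src)
    have hb : DepProj b := (pathCxt Φ).depProj_tgt.baseChange hL
    have key : (homotopyCxt Φ).Joined
        ((pathCxt Φ).composition.op a (b ≫ (homotopyCxt Φ).src) (by simp [hL.w]))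
        ((pathCxt Φ).composition.op a (b ≫ (homotopyCxt Φ).tgt) (by simp [hL.w, homotopy_src])) := by
      refine joined_of_elim _ hb ?_ ?_ ?_
      · simp [IdCxt.Composition.op_src]
      · simp [IdCxt.Composition.op_tgt, homotopy_tgt]
      · intro W i' p' hw
        rw [IdCxt.Composition.precomp, IdCxt.Composition.precomp]
        congr 1
        simp [reassoc_of% hw]
    have := key.precomp (hL.lift (u ≫ (homotopyCxt Φ).tgt) v (by simpa using e))
    simpa [IdCxt.Composition.precomp] using this

theorem op_assoc {Z : C} (p q r : Z ⟶ (pathCxt Φ).obj)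
    (h : p ≫ (pathCxt Φ).tgt = q ≫ (pathCxt Φ).src)
    (h' : q ≫ (pathCxt Φ).tgt = r ≫ (pathCxt Φ).src) :
    (homotopyCxt Φ).Joined
      ((pathCxt Φ).composition.op ((pathCxt Φ).composition.op p q h) r
        (by rw [IdCxt.Composition.op_tgt, h']))
      ((pathCxt Φ).composition.op p ((pathCxt Φ).composition.op q r h')
        (by rw [IdCxt.Composition.op_src, h])) := by
  obtain ⟨K, a, b, hK⟩ := (pathCxt Φ).depProj_tgt.exists_pullback (pathCxt Φ).src
  obtain ⟨L, c, d, hL⟩ := ((pathCxt Φ).depProj_tgt.baseChange hK).comp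
    (pathCxt Φ).depProj_tgt |>.exists_pullback (pathCxt Φ).src
  have hd : DepProj d := (((pathCxt Φ).depProj_tgt.baseChange hK).comp
    (pathCxt Φ).depProj_tgt).baseChange hL
  have e1 : (c ≫ a) ≫ (pathCxt Φ).tgt = (c ≫ b) ≫ (pathCxt Φ).src := by simp [hK.w]
  have e2 : (c ≫ b) ≫ (pathCxt Φ).tgt = d ≫ (pathCxt Φ).src := by simpa using hL.w
  have key : (homotopyCxt Φ).Joined
      ((pathCxt Φ).composition.op ((pathCxt Φ).composition.op (c ≫ a) (c ≫ b) e1) d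
        (by rw [IdCxt.Composition.op_tgt, e2]))
      ((pathCxt Φ).composition.op (c ≫ a) ((pathCxt Φ).composition.op (c ≫ b) d e2)
        (by rw [IdCxt.Composition.op_src, e1])) := by
    refine joined_of_elim _ hd ?_ ?_ ?_
    · simp [IdCxt.Composition.op_src]
    · simp [IdCxt.Composition.op_tgt]
    · intro W i' p' hw
      simp only [IdCxt.Composition.precomp, hw, IdCxt.Composition.op_refl]
  have := key.precomp (hL.lift (hK.lift p q h) r (by simpa using h'))
  simpa [IdCxt.Composition.precomp] using this

theorem refl_op {Z : C} (p : Z ⟶ (pathCxt Φ).obj) :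
    (homotopyCxt Φ).Joined ((pathCxt Φ).composition.op ((p ≫ (pathCxt Φ).src) ≫ (pathCxt Φ).refl) p
      (by simp)) p := by
  have key : (homotopyCxt Φ).Joined ((pathCxt Φ).composition.op
      ((pathCxt Φ).src ≫ (pathCxt Φ).refl) (𝟙 _) (by simp)) (𝟙 _) := by
    refine joined_of_elim (pathCxt Φ) (DepProj.of_isIso (𝟙 _)) ?_ ?_ ?_
    · simp [IdCxt.Composition.op_src]
    · simp [IdCxt.Composition.op_tgt]
    · intro W i' p' hw
      have hw' : i' = p' ≫ (pathCxt Φ).refl := by simpa using hw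
      subst hw'
      simp [IdCxt.Composition.precomp, IdCxt.Composition.op_refl]
  have := key.precomp p
  simpa [IdCxt.Composition.precomp] using this

theorem inverse_op {Z : C} (p : Z ⟶ (pathCxt Φ).obj) :
    (homotopyCxt Φ).Joined ((pathCxt Φ).composition.op (p ≫ (pathCxt Φ).inverse) p (by simp))
      ((p ≫ (pathCxt Φ).tgt) ≫ (pathCxt Φ).refl) := by
  have key : (homotopyCxt Φ).Joined ((pathCxt Φ).composition.op
      (pathCxt Φ).inverse (𝟙 _) (by simp)) ((pathCxt Φ).tgt ≫ (pathCxt Φ).refl) := by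
    refine joined_of_elim (pathCxt Φ) (DepProj.of_isIso (𝟙 _)) ?_ ?_ ?_
    · simp [IdCxt.Composition.op_src]
    · simp [IdCxt.Composition.op_tgt]
    · intro W i' p' hw
      have hw' : i' = p' ≫ (pathCxt Φ).refl := by simpa using hw
      subst hw'
      simp [IdCxt.Composition.precomp, IdCxt.Composition.op_refl]
  have := key.precomp p
  simpa [IdCxt.Composition.precomp] using this

theorem op_inverse {Z : C} (p : Z ⟶ (pathCxt Φ).obj) :
    (homotopyCxt Φ).Joined ((pathCxt Φ).composition.op p (p ≫ (pathCxt Φ).inverse) (by simp))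
      ((p ≫ (pathCxt Φ).src) ≫ (pathCxt Φ).refl) := by
  have key : (homotopyCxt Φ).Joined ((pathCxt Φ).composition.op (𝟙 _)
      (pathCxt Φ).inverse (by simp)) ((pathCxt Φ).src ≫ (pathCxt Φ).refl) := by
    refine joined_of_elim (pathCxt Φ) (DepProj.of_isIso (𝟙 _)) ?_ ?_ ?_
    · simp [IdCxt.Composition.op_src]
    · simp [IdCxt.Composition.op_tgt]
    · intro W i' p' hw
      have hw' : i' = p' ≫ (pathCxt Φ).refl := by simpa using hw
      subst hw'
      simp [IdCxt.Composition.precomp, IdCxt.Composition.op_refl]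
  have := key.precomp p
  simpa [IdCxt.Composition.precomp] using this

theorem joined_inverse {Z : C} {p q : Z ⟶ (pathCxt Φ).obj} (h : (homotopyCxt Φ).Joined p q) :
    (homotopyCxt Φ).Joined (p ≫ (pathCxt Φ).inverse) (q ≫ (pathCxt Φ).inverse) := by
  obtain ⟨h, rfl, rfl⟩ := h
  have key : (homotopyCxt Φ).Joined ((homotopyCxt Φ).src ≫ (pathCxt Φ).inverse)
      ((homotopyCxt Φ).tgt ≫ (pathCxt Φ).inverse) := by
    refine joined_of_elim (homotopyCxt Φ) (DepProj.of_isIso (𝟙 _)) ?_ ?_ ?_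
    · simp [homotopy_tgt]
    · simp [homotopy_src]
    · intro W i' p' hw
      have hw' : i' = p' ≫ (homotopyCxt Φ).refl := by simpa using hw
      subst hw'
      simp
  simpa using key.precomp h

/-- Maps are homotopy classes of paths; composition, identities and inverses are induced by composition,
reflexivity and inversion of paths. -/
noncomputable instance : Groupoid.{u} (FundamentalGroupoid Φ) where
  Hom a b := Quotient (homotopySetoid a b)
  id a := Quotient.mk _ ⟨a.pt ≫ (pathCxt Φ).refl, by simp, by simp⟩
  comp f g := Quotient.map₂
    (fun (p : Path _ _) (q : Path _ _) =>
      (⟨(pathCxt Φ).composition.op p.1 q.1 (p.2.2.trans q.2.1.symm),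
        ((pathCxt Φ).composition.op_src _ _ _).trans p.2.1,
        ((pathCxt Φ).composition.op_tgt _ _ _).trans q.2.2⟩ : Path _ _))
    (fun _ _ hp _ _ hq => joined_op hp hq _ _) f g
  inv f := Quotient.map
    (fun (p : Path _ _) => (⟨p.1 ≫ (pathCxt Φ).inverse, by simp [p.2.2], by simp [p.2.1]⟩ : Path _ _))
    (fun _ _ hp => joined_inverse hp) f
  id_comp f := by
    induction f using Quotient.inductionOn with | _ p
    obtain ⟨p, h1, h2⟩ := p
    refine Quotient.sound ?_
    have := refl_op p
    simp only [h1] at this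
    exact this
  comp_id f := by
    induction f using Quotient.inductionOn with | _ p
    obtain ⟨p, h1, h2⟩ := p
    refine congrArg (Quotient.mk _) (Subtype.ext ?_)
    exact (pathCxt Φ).composition.op_refl _ _ _
  assoc f g h := by
    induction f using Quotient.inductionOn with | _ p
    induction g using Quotient.inductionOn with | _ q
    induction h using Quotient.inductionOn with | _ r
    exact Quotient.sound (op_assoc p.1 q.1 r.1 (p.2.2.trans q.2.1.symm) (q.2.2.trans r.2.1.symm))
  inv_comp f := by
    induction f using Quotient.inductionOn with | _ p
    obtain ⟨p, h1, h2⟩ := p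
    refine Quotient.sound ?_
    have := inverse_op p
    simp only [h2] at this
    exact this
  comp_inv f := by
    induction f using Quotient.inductionOn with | _ p
    obtain ⟨p, h1, h2⟩ := p
    refine Quotient.sound ?_
    have := op_inverse p
    simp only [h1] at this
    exact this

variable {Ψ Ξ : C}

theorem exists_ap (f : Φ ⟶ Ψ) : ∃ φ : (pathCxt Φ).obj ⟶ (pathCxt Ψ).obj,
    (pathCxt Φ).refl ≫ φ = f ≫ (pathCxt Ψ).refl ∧ φ ≫ (pathCxt Ψ).src = (pathCxt Φ).src ≫ f ∧
      φ ≫ (pathCxt Ψ).tgt = (pathCxt Φ).tgt ≫ f :=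
  (pathCxt Ψ).exists_path (pathCxt Φ) (DepProj.of_isIso (𝟙 _)) (pathCxt Φ).refl_isPullback _ _ _
    (isTerminal.hom_ext _ _) (by simp) (by simp)

/-- The action of `f` on paths, given by elimination, with `f(r(x)) = r(f(x))`. -/
noncomputable def ap (f : Φ ⟶ Ψ) : (pathCxt Φ).obj ⟶ (pathCxt Ψ).obj := (exists_ap f).choose

@[simp] theorem refl_ap (f : Φ ⟶ Ψ) : (pathCxt Φ).refl ≫ ap f = f ≫ (pathCxt Ψ).refl :=
  (exists_ap f).choose_spec.1
@[simp] theorem ap_src (f : Φ ⟶ Ψ) : ap f ≫ (pathCxt Ψ).src = (pathCxt Φ).src ≫ f :=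
  (exists_ap f).choose_spec.2.1
@[simp] theorem ap_tgt (f : Φ ⟶ Ψ) : ap f ≫ (pathCxt Ψ).tgt = (pathCxt Φ).tgt ≫ f :=
  (exists_ap f).choose_spec.2.2

theorem joined_ap (f : Φ ⟶ Ψ) {Z : C} {p q : Z ⟶ (pathCxt Φ).obj}
    (h : (homotopyCxt Φ).Joined p q) : (homotopyCxt Ψ).Joined (p ≫ ap f) (q ≫ ap f) := by
  obtain ⟨h, rfl, rfl⟩ := h
  have key : (homotopyCxt Ψ).Joined ((homotopyCxt Φ).src ≫ ap f) ((homotopyCxt Φ).tgt ≫ ap f) := by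
    refine joined_of_elim (homotopyCxt Φ) (DepProj.of_isIso (𝟙 _)) ?_ ?_ ?_
    · simp [reassoc_of% (homotopy_src (Φ := Φ))]
    · simp [reassoc_of% (homotopy_tgt (Φ := Φ))]
    · intro W i' p' hw
      have hw' : i' = p' ≫ (homotopyCxt Φ).refl := by simpa using hw
      subst hw'
      simp
  simpa using key.precomp h

theorem op_ap (f : Φ ⟶ Ψ) {Z : C} (p q : Z ⟶ (pathCxt Φ).obj)
    (h : p ≫ (pathCxt Φ).tgt = q ≫ (pathCxt Φ).src) :
    (homotopyCxt Ψ).Joined ((pathCxt Φ).composition.op p q h ≫ ap f)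
      ((pathCxt Ψ).composition.op (p ≫ ap f) (q ≫ ap f) (by simp [reassoc_of% h])) := by
  obtain ⟨K, a, b, hK⟩ := (pathCxt Φ).depProj_tgt.exists_pullback (pathCxt Φ).src
  have key : (homotopyCxt Ψ).Joined ((pathCxt Φ).composition.op a b hK.w ≫ ap f)
      ((pathCxt Ψ).composition.op (a ≫ ap f) (b ≫ ap f) (by simp [reassoc_of% hK.w])) := by
    refine joined_of_elim (pathCxt Φ) ((pathCxt Φ).depProj_tgt.baseChange hK) ?_ ?_ ?_
    · simp [IdCxt.Composition.op_src, reassoc_of% ((pathCxt Φ).composition.op_src a b hK.w)]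
    · simp [IdCxt.Composition.op_tgt, reassoc_of% ((pathCxt Φ).composition.op_tgt a b hK.w)]
    · intro W i' p' hw
      rw [← Category.assoc]
      have e : i' ≫ b ≫ ap f = (p' ≫ f) ≫ (pathCxt Ψ).refl := by
        rw [reassoc_of% hw, refl_ap, Category.assoc]
      simp only [IdCxt.Composition.precomp, hw, IdCxt.Composition.op_refl, e, Category.assoc]
      simp only [← Category.assoc, IdCxt.Composition.op_refl]
  have := key.precomp (hK.lift p q h)
  rw [← Category.assoc] at this
  simp only [IdCxt.Composition.precomp] at this
  simpa using this

/-- The functor of fundamental groupoids induced by a context morphism. -/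
noncomputable def map (f : Φ ⟶ Ψ) : FundamentalGroupoid Φ ⥤ FundamentalGroupoid Ψ where
  obj a := ⟨a.pt ≫ f⟩
  map p := Quotient.map
    (fun (p : Path _ _) => (⟨p.1 ≫ ap f, by simp [reassoc_of% p.2.1], by simp [reassoc_of% p.2.2]⟩ : Path _ _))
    (fun _ _ hp => joined_ap f hp) p
  map_id a := congrArg (Quotient.mk _) (Subtype.ext (by simp))
  map_comp p q := by
    induction p using Quotient.inductionOn with | _ p
    induction q using Quotient.inductionOn with | _ q
    exact Quotient.sound (op_ap f p.1 q.1 (p.2.2.trans q.2.1.symm))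

theorem eqToHom_comp_mk {a a' b b' : FundamentalGroupoid Φ} (h : a = a') (h' : b = b')
    (p : Path a' b') (p' : Path a b) (e : (homotopyCxt Φ).Joined p'.1 p.1) :
    (Quotient.mk _ p' : a ⟶ b) = eqToHom h ≫ (Quotient.mk _ p : a' ⟶ b') ≫ eqToHom h'.symm := by
  subst h; subst h'
  simp only [eqToHom_refl, Category.id_comp, Category.comp_id]
  exact Quotient.sound e

theorem joined_ap_id {Z : C} (p : Z ⟶ (pathCxt Φ).obj) :
    (homotopyCxt Φ).Joined (p ≫ ap (𝟙 Φ)) p := by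
  have key : (homotopyCxt Φ).Joined (ap (𝟙 Φ)) (𝟙 _) := by
    refine joined_of_elim (pathCxt Φ) (DepProj.of_isIso (𝟙 _)) (by simp) (by simp) ?_
    intro W i' p' hw
    have hw' : i' = p' ≫ (pathCxt Φ).refl := by simpa using hw
    subst hw'
    simp
  simpa using key.precomp p

theorem joined_ap_comp (f : Φ ⟶ Ψ) (g : Ψ ⟶ Ξ) {Z : C} (p : Z ⟶ (pathCxt Φ).obj) :
    (homotopyCxt Ξ).Joined (p ≫ ap (f ≫ g)) ((p ≫ ap f) ≫ ap g) := by
  have key : (homotopyCxt Ξ).Joined (ap (f ≫ g)) (ap f ≫ ap g) := by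
    refine joined_of_elim (pathCxt Φ) (DepProj.of_isIso (𝟙 _))
      (by simp [reassoc_of% (ap_src f)]) (by simp [reassoc_of% (ap_tgt f)]) ?_
    intro W i' p' hw
    have hw' : i' = p' ≫ (pathCxt Φ).refl := by simpa using hw
    subst hw'
    simp [reassoc_of% (refl_ap f)]
  simpa using key.precomp p

theorem map_id' : map (𝟙 Φ) = 𝟭 _ := by
  refine CategoryTheory.Functor.ext (fun a => FundamentalGroupoid.ext (Category.comp_id _)) ?_
  intro a b p
  induction p using Quotient.inductionOn with | _ p
  exact eqToHom_comp_mk (FundamentalGroupoid.ext (Category.comp_id _))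
    (FundamentalGroupoid.ext (Category.comp_id _)) p _ (joined_ap_id p.1)

theorem map_comp' (f : Φ ⟶ Ψ) (g : Ψ ⟶ Ξ) : map (f ≫ g) = map f ⋙ map g := by
  refine CategoryTheory.Functor.ext (fun a => FundamentalGroupoid.ext (Category.assoc _ _ _).symm) ?_
  intro a b p
  induction p using Quotient.inductionOn with | _ p
  exact eqToHom_comp_mk (FundamentalGroupoid.ext (Category.assoc _ _ _).symm)
    (FundamentalGroupoid.ext (Category.assoc _ _ _).symm) _ _ (joined_ap_comp f g p.1)

end FundamentalGroupoid

/-- The fundamental groupoid functor. -/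
noncomputable def fundamentalGroupoid : C ⥤ Grpd.{u, u} where
  obj Φ := Grpd.of (FundamentalGroupoid Φ)
  map f := FundamentalGroupoid.map f
  map_id Φ := FundamentalGroupoid.map_id'
  map_comp f g := FundamentalGroupoid.map_comp' f g

end Groupoid

end Abstract

namespace DependentTypeTheory

section Substitution

variable {S : Signature.{u}}

def baseOf {X : Type u} {m : ℕ} : (k : ℕ) → (Fin (m + k) → X) → Fin m → X
  | 0, σ => σ
  | k + 1, σ => baseOf k fun i => σ i.succ

def telOf {X : Type u} {m : ℕ} : (k : ℕ) → (Fin (m + k) → X) → Fin k → X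
  | 0, _ => Fin.elim0
  | k + 1, σ => scons (σ 0) (telOf k fun i => σ i.succ)

theorem scons_eta {X : Type u} {m : ℕ} (σ : Fin (m + 1) → X) : scons (σ 0) (fun i => σ i.succ) = σ := by
  funext i; exact Fin.cases rfl (fun _ => rfl) i

theorem appendSub_eta {m n : ℕ} (k : ℕ) (σ : Fin (m + k) → Expr S n) :
    appendSub (baseOf k σ) (telOf k σ) = σ := by
  induction k with
  | zero => rfl
  | succ k ih =>
    refine Eq.trans ?_ (scons_eta (m := m + k) σ)
    simp only [appendSub, telOf, baseOf, scons_zero, scons_succ]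
    rw [ih]

theorem baseOf_appendSub {m n : ℕ} {k : ℕ} (σ : Fin m → Expr S n) (t : Fin k → Expr S n) :
    baseOf k (appendSub σ t) = σ := by
  induction k with
  | zero => rfl
  | succ k ih => exact ih _

theorem telOf_appendSub {m n : ℕ} {k : ℕ} (σ : Fin m → Expr S n) (t : Fin k → Expr S n) :
    telOf k (appendSub σ t) = t := by
  induction k with
  | zero => funext i; exact i.elim0
  | succ k ih =>
    refine Eq.trans ?_ (scons_eta t)
    exact congrArg (scons (t 0)) (ih _)

theorem upN_appendSub {l m n : ℕ} {k : ℕ} (s : Fin l → Expr S m) (w : Fin m → Expr S n)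
    (t : Fin k → Expr S n) :
    (fun i => (upN s k i).subst (appendSub w t)) = appendSub (fun i => (s i).subst w) t := by
  induction k with
  | zero => rfl
  | succ k ih =>
    funext i
    refine Fin.cases rfl (fun j => ?_) i
    simp only [upN, up, scons_succ, appendSub, subst_rename]
    exact congrFun (ih _) j

theorem appendSub_subst {l m n : ℕ} {k : ℕ} (s : Fin l → Expr S m) (t : Fin k → Expr S m)
    (w : Fin m → Expr S n) :
    (fun i => (appendSub s t i).subst w) = appendSub (fun i => (s i).subst w) fun i => (t i).subst w := by
  induction k with
  | zero => rfl
  | succ k ih =>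
    funext i
    exact Fin.cases rfl (fun j => congrFun (ih _) j) i

theorem up_eq_subst_wk {m n : ℕ} (σ : Fin m → Expr S n) (i : Fin m) :
    up σ i.succ = (σ i).subst (wk S n) := rename_eq_subst _ _

theorem wk_up {m n : ℕ} (σ : Fin m → Expr S n) (A : Expr S m) :
    (A.subst (wk S m)).subst (up σ) = (A.subst σ).subst (wk S n) := by
  rw [subst_subst, subst_subst]
  congr 1
  funext i
  exact up_eq_subst_wk σ i

theorem Tel.subst_subst {l m n k : ℕ} (Θ : Tel S l k) (σ : Fin l → Expr S m) (τ : Fin m → Expr S n) :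
    (Θ.subst σ).subst τ = Θ.subst fun i => (σ i).subst τ := by
  induction Θ with
  | nil => rfl
  | snoc Θ A ih => simp only [Tel.subst, ih, Expr.subst_subst, upN_subst_subst]

theorem reflSub_up {m n : ℕ} (γ : Fin m → Expr S n) :
    (fun i => (reflSub S m i).subst (up γ)) = fun i => (up (up (up γ)) i).subst (reflSub S n) := by
  funext i
  refine Fin.cases rfl (fun i => Fin.cases rfl (fun i => Fin.cases rfl (fun i => ?_) i) i) i
  simp only [up, reflSub, scons_succ, Expr.subst_rename]
  exact (rename_eq_subst _ _)

/-- The raw weakening of `k` variables. -/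
def wkN (S : Signature.{u}) (n : ℕ) : (k : ℕ) → Fin n → Expr S (n + k)
  | 0 => var
  | k + 1 => fun i => (wkN S n k i).subst (wk S (n + k))

end Substitution

variable {T : DependentTypeTheory.{u}}

section Raw

variable {m n : ℕ} {Γ : Ctx T.S m} {Δ : Ctx T.S n}

theorem isSub_up {σ : Fin m → Expr T.S n} (hσ : IsSub T.H Δ Γ σ) {A : Expr T.S m}
    (hA : T.H _ Δ (.isType (A.subst σ))) : IsSub T.H (Δ.snoc (A.subst σ)) (Γ.snoc A) (up σ) := by
  have e : (fun i => up σ i.succ) = fun i => (σ i).subst (wk T.S n) := funext (up_eq_subst_wk σ)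
  refine ⟨?_, ?_⟩
  · rw [e]; exact isSub_wk_comp hA hσ
  · have := T.assumption hA
    rw [e, ← Expr.subst_subst]
    exact this

theorem append_wf {σ : Fin m → Expr T.S n} (hσ : IsSub T.H Δ Γ σ) (hΔ : WF T.H Δ) {k : ℕ}
    {Θ : Tel T.S m k} (hΘ : WF T.H (Γ.append Θ)) :
    WF T.H (Δ.append (Θ.subst σ)) ∧
      IsSub T.H (Δ.append (Θ.subst σ)) (Γ.append Θ) (upN σ k) := by
  induction Θ with
  | nil => exact ⟨hΔ, hσ⟩
  | snoc Θ A ih =>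
    obtain ⟨h1, h2⟩ := ih hΘ.1
    have hA := T.substitution hΘ.2 h1 h2
    exact ⟨⟨h1, hA⟩, isSub_up h2 hA⟩

theorem wf_of_append {k : ℕ} {Θ : Tel T.S m k} (h : WF T.H (Γ.append Θ)) : WF T.H Γ := by
  induction Θ with
  | nil => exact h
  | snoc Θ A ih => exact ih h.1

theorem isSub_appendSub {l : ℕ} {Ξ : Ctx T.S l} {s : Fin m → Expr T.S l} {w : Fin l → Expr T.S n}
    {k : ℕ} {Θ : Tel T.S m k} {t : Fin k → Expr T.S n} (hw : IsSub T.H Δ Ξ w)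
    (h : IsSub T.H Δ (Γ.append Θ) (appendSub (fun i => (s i).subst w) t)) :
    IsSub T.H Δ (Ξ.append (Θ.subst s)) (appendSub w t) := by
  induction Θ with
  | nil => exact hw
  | snoc Θ A ih =>
    refine ⟨ih h.1, ?_⟩
    have := h.2
    simp only [appendSub, scons_succ, scons_zero] at this ⊢
    rw [Expr.subst_subst, upN_appendSub]
    exact this

theorem isSub_baseOf {k : ℕ} {Θ : Tel T.S m k} {σ : Fin (m + k) → Expr T.S n}
    (h : IsSub T.H Δ (Γ.append Θ) σ) : IsSub T.H Δ Γ (baseOf k σ) := by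
  induction Θ with
  | nil => exact h
  | snoc Θ A ih => exact ih h.1

theorem idCtx_subst {γ : Fin m → Expr T.S n} (hγ : IsSub T.H Δ Γ γ) (hΔ : WF T.H Δ)
    {A : Expr T.S m} (hA : WF T.H (Γ.idCtx A)) :
    WF T.H (Δ.idCtx (A.subst γ)) ∧
      IsSub T.H (Δ.idCtx (A.subst γ)) (Γ.idCtx A) (up (up (up γ))) := by
  have := append_wf (Θ := ((Tel.nil.snoc A).snoc (A.subst (wk T.S m))).snoc
    (.Id ((A.subst (wk T.S m)).subst (wk T.S (m + 1))) (var 1) (var 0))) hγ hΔ hA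
  have e : Δ.append (Tel.subst γ (((Tel.nil.snoc A).snoc (A.subst (wk T.S m))).snoc
    (.Id ((A.subst (wk T.S m)).subst (wk T.S (m + 1))) (var 1) (var 0)))) = Δ.idCtx (A.subst γ) := by
    have e1 := wk_up γ A
    have e2 := wk_up (up γ) (A.subst (wk T.S m))
    rw [e1] at e2
    show ((Δ.snoc (A.subst γ)).snoc ((A.subst (wk T.S m)).subst (up γ))).snoc
      (.Id (((A.subst (wk T.S m)).subst (wk T.S (m + 1))).subst (up (up γ))) (var 1) (var 0)) = _
    rw [e2, e1]
    rfl
  rw [e] at this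
  exact this

theorem idCtx_wf {A : Expr T.S m} (hA : T.H _ Γ (.isType A)) : WF T.H (Γ.idCtx A) := by
  have hΓ := T.wf hA
  have h1 : T.H _ (Γ.snoc A) (.isType (A.subst (wk T.S m))) := T.weakening hA hA
  have h2 := T.weakening (T.assumption hA) h1
  exact ⟨⟨⟨hΓ, hA⟩, h1⟩, T.id_form h2 (T.assumption h1)⟩

theorem reflSub_isSub {A : Expr T.S m} (hA : T.H _ Γ (.isType A)) :
    IsSub T.H (Γ.snoc A) (Γ.idCtx A) (reflSub T.S m) := by
  have hΓ := T.wf hA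
  have h0 := T.assumption hA
  have hv := isSub_var (T := T) (Γ := Γ.snoc A) ⟨hΓ, hA⟩
  refine ⟨⟨⟨hv.1, h0⟩, ?_⟩, ?_⟩
  · exact (congrArg (fun B => T.H _ (Γ.snoc A) (.hasType (var 0) B))
      (Expr.subst_subst A (wk T.S m) (fun i => reflSub T.S m i.succ.succ))).mpr h0
  · exact (congrArg (fun B => T.H _ (Γ.snoc A) (.hasType (.refl (var 0)) (.Id B (var 0) (var 0))))
      ((Expr.subst_subst (A.subst (wk T.S m)) (wk T.S (m + 1)) (fun i => reflSub T.S m i.succ)).trans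
        (Expr.subst_subst A (wk T.S m) _))).mpr (T.id_intro h0)

/-- The eliminator at a tuple `(γ, a, b, p, t)`. -/
def Jat {k : ℕ} (d : Expr T.S (m + 1 + k)) (σ : Fin (m + 3) → Expr T.S n) (t : Fin k → Expr T.S n) :
    Expr T.S n :=
  .J (σ 2) (σ 1) (σ 0) (d.subst (upN (up fun i => σ i.succ.succ.succ) k)) t

theorem Jat_subst {l k : ℕ} (d : Expr T.S (m + 1 + k)) (σ : Fin (m + 3) → Expr T.S n)
    (t : Fin k → Expr T.S n) (τ : Fin n → Expr T.S l) :
    (Jat d σ t).subst τ = Jat d (fun i => (σ i).subst τ) fun i => (t i).subst τ := by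
  simp only [Jat, Expr.subst, Expr.subst_subst, upN_subst_subst, up_subst_subst]

variable {A : Expr T.S m} {k : ℕ} {Θ : Tel T.S (m + 3) k} {C : Expr T.S (m + 3 + k)}
  {d : Expr T.S (m + 1 + k)}

theorem tel_aux (γ : Fin m → Expr T.S n) :
    (Θ.subst (up (up (up γ)))).subst (reflSub T.S n) = (Θ.subst (reflSub T.S m)).subst (up γ) := by
  rw [Tel.subst_subst, Tel.subst_subst, reflSub_up]

theorem type_aux (γ : Fin m → Expr T.S n) :
    (C.subst (upN (up (up (up γ))) k)).subst (upN (reflSub T.S n) k) =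
      (C.subst (upN (reflSub T.S m) k)).subst (upN (up γ) k) := by
  rw [Expr.subst_subst, Expr.subst_subst, upN_subst_subst, upN_subst_subst, reflSub_up]

theorem premises (hC : T.H _ ((Γ.idCtx A).append Θ) (.isType C))
    (hd : T.H _ ((Γ.snoc A).append (Θ.subst (reflSub T.S m)))
      (.hasType d (C.subst (upN (reflSub T.S m) k))))
    (hΔ : WF T.H Δ) {γ : Fin m → Expr T.S n} (hγ : IsSub T.H Δ Γ γ) :
    T.H _ ((Δ.idCtx (A.subst γ)).append (Θ.subst (up (up (up γ)))))
        (.isType (C.subst (upN (up (up (up γ))) k))) ∧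
    T.H _ ((Δ.snoc (A.subst γ)).append ((Θ.subst (up (up (up γ)))).subst (reflSub T.S n)))
      (.hasType (d.subst (upN (up γ) k))
        ((C.subst (upN (up (up (up γ))) k)).subst (upN (reflSub T.S n) k))) := by
  have hZ := T.wf hC
  have hY : WF T.H (Γ.idCtx A) := wf_of_append hZ
  obtain ⟨h1, h2⟩ := idCtx_subst hγ hΔ hY
  obtain ⟨h3, h4⟩ := append_wf h2 h1 hZ
  have hA := T.substitution hY.1.1.2 hΔ hγ
  obtain ⟨h5, h6⟩ := append_wf (isSub_up hγ hA) ⟨hΔ, hA⟩ (T.wf hd)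
  refine ⟨T.substitution hC h3 h4, ?_⟩
  rw [tel_aux, type_aux]
  exact T.substitution hd h5 h6

theorem up3_scons (γ : Fin m → Expr T.S n) (p b a : Expr T.S n) :
    (fun i => (up (up (up γ)) i).subst (scons p (scons b (scons a var)))) =
      scons p (scons b (scons a γ)) := by
  funext i
  refine Fin.cases rfl (fun i => Fin.cases rfl (fun i => Fin.cases rfl (fun i => ?_) i) i) i
  simp only [up, scons_succ, Expr.subst_rename]
  exact subst_var _

theorem up_scons (γ : Fin m → Expr T.S n) (a : Expr T.S n) :
    (fun i => (up γ i).subst (scons a var)) = scons a γ := by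
  funext i
  refine Fin.cases rfl (fun i => ?_) i
  simp only [up, scons_succ, Expr.subst_rename]
  exact subst_var _

theorem scons3_eta (σ : Fin (m + 3) → Expr T.S n) :
    scons (σ 0) (scons (σ 1) (scons (σ 2) fun i => σ i.succ.succ.succ)) = σ := by
  funext i
  exact Fin.cases rfl (fun i => Fin.cases rfl (fun i => Fin.cases rfl (fun i => rfl) i) i) i

theorem Jat_hasType (hC : T.H _ ((Γ.idCtx A).append Θ) (.isType C))
    (hd : T.H _ ((Γ.snoc A).append (Θ.subst (reflSub T.S m)))
      (.hasType d (C.subst (upN (reflSub T.S m) k))))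
    (hΔ : WF T.H Δ) {σ : Fin (m + 3) → Expr T.S n} {t : Fin k → Expr T.S n}
    (h : IsSub T.H Δ ((Γ.idCtx A).append Θ) (appendSub σ t)) :
    T.H _ Δ (.hasType (Jat d σ t) (C.subst (appendSub σ t))) := by
  have hb := isSub_baseOf h
  rw [baseOf_appendSub] at hb
  obtain ⟨⟨⟨hγ, ha⟩, hb'⟩, hp⟩ := hb
  obtain ⟨h1, h2⟩ := premises hC hd hΔ hγ
  have hw : IsSub T.H Δ (Δ.idCtx (A.subst fun i => σ i.succ.succ.succ))
      (scons (σ 0) (scons (σ 1) (scons (σ 2) var))) := by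
    refine ⟨⟨⟨isSub_var hΔ, ?_⟩, ?_⟩, ?_⟩
    · exact (congrArg (fun B => T.H n Δ (.hasType (σ 2) B)) (subst_var _)).mpr ha
    · refine (congrArg (fun B => T.H n Δ (.hasType (σ 1) B)) ?_).mp hb'
      exact (Expr.subst_subst A (wk T.S m) _).trans ((subst_var _).symm.trans
        (Expr.subst_subst _ (wk T.S n) (scons (σ 2) var)).symm)
    · refine (congrArg (fun B => T.H n Δ (.hasType (σ 0) (.Id B (σ 2) (σ 1)))) ?_).mp hp
      refine ((Expr.subst_subst _ (wk T.S (m + 1)) _).trans (Expr.subst_subst A (wk T.S m) _)).trans ?_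
      exact ((Expr.subst_subst _ (wk T.S (n + 1)) (scons (σ 1) (scons (σ 2) var))).trans
        ((Expr.subst_subst _ (wk T.S n) _).trans (subst_var _))).symm
  have := T.id_elim (a := σ 2) (b := σ 1) (p := σ 0) (t := t) h1 h2
    (isSub_appendSub hw (by rw [up3_scons, scons3_eta]; exact h))
  rw [Expr.subst_subst, upN_appendSub, up3_scons, scons3_eta] at this
  exact this

theorem Jat_refl (hC : T.H _ ((Γ.idCtx A).append Θ) (.isType C))
    (hd : T.H _ ((Γ.snoc A).append (Θ.subst (reflSub T.S m)))
      (.hasType d (C.subst (upN (reflSub T.S m) k))))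
    (hΔ : WF T.H Δ) {σ : Fin (m + 1) → Expr T.S n} {t : Fin k → Expr T.S n}
    (h : IsSub T.H Δ ((Γ.snoc A).append (Θ.subst (reflSub T.S m))) (appendSub σ t)) :
    T.H _ Δ (.tmEq (Jat d (fun i => (reflSub T.S m i).subst σ) t) (d.subst (appendSub σ t))
      (C.subst (appendSub (fun i => (reflSub T.S m i).subst σ) t))) := by
  have hb := isSub_baseOf h
  rw [baseOf_appendSub] at hb
  obtain ⟨hγ, ha⟩ := hb
  obtain ⟨h1, h2⟩ := premises hC hd hΔ hγ
  have hw : IsSub T.H Δ (Δ.snoc (A.subst fun i => σ i.succ)) (scons (σ 0) var) := by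
    refine ⟨isSub_var hΔ, ?_⟩
    exact (congrArg (fun B => T.H n Δ (.hasType (σ 0) B)) (subst_var _)).mpr ha
  have := T.id_comp (a := σ 0) (t := t) h1 h2 (by
    rw [tel_aux]
    exact isSub_appendSub hw (by rw [up_scons, scons_eta]; exact h))
  rw [Expr.subst_subst, Expr.subst_subst, upN_appendSub, upN_appendSub, up3_scons, up_scons,
    scons_eta] at this
  have e : (fun i => (reflSub T.S m i).subst σ) =
      scons (.refl (σ 0)) (scons (σ 0) (scons (σ 0) fun i => σ i.succ)) := by
    rw [← scons3_eta (fun i => (reflSub T.S m i).subst σ)]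
    rfl
  rw [e, scons_eta]
  exact this

end Raw

end DependentTypeTheory

namespace DependentTypeTheory

open ContextCategory

variable {T : DependentTypeTheory.{u}}

namespace Cxt

/-- Context extension. -/
def snoc (Γ : T.Cxt) (A : Expr T.S Γ.len) (h : T.H _ Γ.ctx (.isType A)) : T.Cxt :=
  ⟨Γ.len + 1, Γ.ctx.snoc A, Γ.wf, h⟩

/-- Concatenation with a dependent context. -/
def append (Γ : T.Cxt) {k : ℕ} (Θ : Tel T.S Γ.len k) (h : WF T.H (Γ.ctx.append Θ)) : T.Cxt :=
  ⟨Γ.len + k, Γ.ctx.append Θ, h⟩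

/-- The map of contexts represented by a tuple of terms. -/
def toHom {Δ Γ : T.Cxt} (σ : Fin Γ.len → Expr T.S Δ.len) (h : IsSub T.H Δ.ctx Γ.ctx σ) : Δ ⟶ Γ :=
  Quotient.mk (morSetoid Δ Γ) ⟨σ, h⟩

theorem toHom_eq_iff {Δ Γ : T.Cxt} {σ τ : Fin Γ.len → Expr T.S Δ.len}
    {h : IsSub T.H Δ.ctx Γ.ctx σ} {h' : IsSub T.H Δ.ctx Γ.ctx τ} :
    toHom σ h = toHom τ h' ↔ SubEq T.H Δ.ctx Γ.ctx σ τ :=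
  ⟨fun e => Quotient.exact e, fun e => Quotient.sound e⟩

theorem toHom_comp {Ξ Δ Γ : T.Cxt} {τ : Fin Δ.len → Expr T.S Ξ.len} {σ : Fin Γ.len → Expr T.S Δ.len}
    (hτ : IsSub T.H Ξ.ctx Δ.ctx τ) (hσ : IsSub T.H Δ.ctx Γ.ctx σ) :
    toHom τ hτ ≫ toHom σ hσ = toHom (fun i => (σ i).subst τ) (isSub_comp Ξ.wf hτ hσ) := rfl

theorem exists_rep {Δ Γ : T.Cxt} (f : Δ ⟶ Γ) : ∃ σ h, f = toHom σ h := by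
  induction f using Quotient.inductionOn with | _ σ
  exact ⟨σ.1, σ.2, rfl⟩

/-- The display map `(Γ, x ∈ A) ⟶ Γ`. -/
def drop (Γ : T.Cxt) (A : Expr T.S Γ.len) (h : T.H _ Γ.ctx (.isType A)) : Γ.snoc A h ⟶ Γ :=
  toHom (wk T.S _) (isSub_wk (Γ.snoc A h).wf)

theorem isSub_up' {Δ Γ : T.Cxt} {σ : Fin Γ.len → Expr T.S Δ.len} (hσ : IsSub T.H Δ.ctx Γ.ctx σ)
    {A : Expr T.S Γ.len} {B : Expr T.S Δ.len} (e : A.subst σ = B) (hB : T.H _ Δ.ctx (.isType B)) :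
    IsSub T.H (Δ.ctx.snoc B) (Γ.ctx.snoc A) (up σ) := by
  subst e; exact isSub_up hσ hB

theorem isPullback_up {Δ Γ : T.Cxt} {σ : Fin Γ.len → Expr T.S Δ.len}
    (hσ : IsSub T.H Δ.ctx Γ.ctx σ) {A : Expr T.S Γ.len} (hA : T.H _ Γ.ctx (.isType A))
    {B : Expr T.S Δ.len} (e : A.subst σ = B) (hB : T.H _ Δ.ctx (.isType B)) :
    IsPullback (toHom (Δ := Δ.snoc B hB) (Γ := Γ.snoc A hA) (up σ) (isSub_up' hσ e hB))
      (Δ.drop B hB) (Γ.drop A hA) (toHom σ hσ) := by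
  subst e
  have key {l : ℕ} (φ : Fin (Δ.len + 1) → Expr T.S l) :
      (fun i => (up σ i.succ).subst φ) = fun i => (σ i).subst fun j => φ j.succ := by
    funext i; exact subst_rename _ _ _
  refine IsPullback.mk' ?_ ?_ ?_
  · refine congrArg (Quotient.mk _) (Subtype.ext (funext fun i => ?_))
    exact rename_eq_subst _ _
  · intro X φ φ' h h'
    obtain ⟨φ : Fin (Δ.len + 1) → _, hφ, rfl⟩ := exists_rep φ
    obtain ⟨φ' : Fin (Δ.len + 1) → _, hφ', rfl⟩ := exists_rep φ'
    have h1 := (toHom_eq_iff.1 h).2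
    have h2 := toHom_eq_iff.1 h'
    refine toHom_eq_iff.2 ⟨h2, ?_⟩
    refine (congrArg (fun B => T.H _ X.ctx (.tmEq (φ 0) (φ' 0) B)) ?_).mp h1
    exact (congrArg (Expr.subst · A) (key φ)).trans (Expr.subst_subst _ _ _).symm
  · intro X a b h
    obtain ⟨a : Fin (Γ.len + 1) → _, ha, rfl⟩ := exists_rep a
    obtain ⟨b, hb, rfl⟩ := exists_rep b
    have h1 := toHom_eq_iff.1 h
    have hσb := isSub_comp X.wf hb hσ
    have hc := T.substitution_type_congr hA X.wf ha.1 hσb h1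
    have h0 : T.H _ X.ctx (.hasType (a 0) ((A.subst σ).subst b)) := by
      rw [Expr.subst_subst]; exact T.tm_conv ha.2 hc
    refine ⟨toHom (Γ := Δ.snoc _ hB) (scons (a 0) b) ⟨hb, h0⟩, ?_, rfl⟩
    refine toHom_eq_iff.2 ⟨?_, ?_⟩
    · refine (congrArg (fun s => SubEq T.H X.ctx Γ.ctx s fun i => a i.succ) (key (scons (a 0) b))).mpr ?_
      exact subEq_symm Γ.wf X.wf ha.1 hσb h1
    · refine (congrArg (fun B => T.H _ X.ctx (.tmEq (a 0) (a 0) B)) ?_).mpr (T.tm_refl h0)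
      exact (congrArg (Expr.subst · A) (key (scons (a 0) b))).trans (Expr.subst_subst _ _ _).symm

end Cxt

open Cxt

noncomputable section

/-- The empty context `( )`. -/
def emptyCxt : T.Cxt := ⟨0, .nil, trivial⟩

def emptyIsTerminal : IsTerminal (emptyCxt (T := T)) :=
  IsTerminal.ofUniqueHom (fun _ => toHom Fin.elim0 trivial) (fun _ f => by
    obtain ⟨σ, h, rfl⟩ := exists_rep f
    exact toHom_eq_iff.2 trivial)

/-- A representative of a map of contexts. -/
def rep {Δ Γ : T.Cxt} (f : Δ ⟶ Γ) : Fin Γ.len → Expr T.S Δ.len := f.out.1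
theorem rep_isSub {Δ Γ : T.Cxt} (f : Δ ⟶ Γ) : IsSub T.H Δ.ctx Γ.ctx (rep f) := f.out.2
theorem toHom_rep {Δ Γ : T.Cxt} (f : Δ ⟶ Γ) : toHom (rep f) (rep_isSub f) = f := Quotient.out_eq f

/-- The types in context `Γ` are the derivable judgements `(Γ) A ∈ Type`; display maps are the projections
that forget the last variable. -/
instance : ContextCategory T.Cxt where
  empty := emptyCxt
  isTerminal := emptyIsTerminal
  Ty Γ := {A : Expr T.S Γ.len // T.H _ Γ.ctx (.isType A)}
  ext {Γ} A := Γ.snoc A.1 A.2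
  proj {Γ} A := Γ.drop A.1 A.2
  sub {Δ Γ} f A := ⟨A.1.subst (rep f), T.substitution A.2 Δ.wf (rep_isSub f)⟩
  top f A := toHom (up (rep f)) (isSub_up' (rep_isSub f) rfl
    (T.substitution A.2 (Cxt.wf _) (rep_isSub f)))
  isPullback {Δ Γ} f A := by
    have := isPullback_up (rep_isSub f) A.2 rfl (T.substitution A.2 Δ.wf (rep_isSub f))
    rw [toHom_rep] at this
    exact this

def toTy (Γ : T.Cxt) (A : Expr T.S Γ.len) (h : T.H _ Γ.ctx (.isType A)) : Ty Γ :=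
  Subtype.mk A h

def ofTy {Γ : T.Cxt} (A : Ty Γ) : {A : Expr T.S Γ.len // T.H _ Γ.ctx (.isType A)} := A

def depCxtOf : {n : ℕ} → (Γ : Ctx T.S n) → (h : WF T.H Γ) → DepCxt (empty : T.Cxt) ⟨n, Γ, h⟩
  | _, .nil, _ => (DepCxt.nil : DepCxt (empty : T.Cxt) empty)
  | _, .snoc Γ A, h => (depCxtOf Γ h.1).snoc (toTy ⟨_, Γ, h.1⟩ A h.2)

instance : Contextual T.Cxt where
  cxt Φ := depCxtOf Φ.ctx Φ.wf

/-- The type `Id_A(x, y)` in context `(Γ, x ∈ A, y ∈ A)`. -/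
def idTy {S : Signature.{u}} {n : ℕ} (A : Expr S n) : Expr S (n + 2) :=
  .Id ((A.subst (wk S n)).subst (wk S (n + 1))) (var 1) (var 0)

theorem refl_snd_aux (S : Signature.{u}) (n : ℕ) :
    (fun i => ((up (wk S n) i).subst (wk S (n + 2))).subst (reflSub S n)) = var := by
  funext i
  exact Fin.cases rfl (fun j => rfl) i

def idCxt (Γ : T.Cxt) (A : Expr T.S Γ.len) (h : T.H _ Γ.ctx (.isType A)) : T.Cxt :=
  ⟨Γ.len + 3, Γ.ctx.idCtx A, idCtx_wf h⟩

section Elim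

theorem isSub_wkN {m k : ℕ} {Γ : Ctx T.S m} {Θ : Tel T.S m k} (h : WF T.H (Γ.append Θ)) :
    IsSub T.H (Γ.append Θ) Γ (wkN T.S m k) := by
  induction Θ with
  | nil => exact isSub_var h
  | snoc Θ A ih => exact isSub_wk_comp h.2 (ih h.1)

def dropN (Γ : T.Cxt) {k : ℕ} (Θ : Tel T.S Γ.len k) (h : WF T.H (Γ.ctx.append Θ)) :
    Γ.append Θ h ⟶ Γ := toHom (wkN T.S _ k) (isSub_wkN h)

theorem exists_tel {Γ Δ : T.Cxt} (Θ : DepCxt Γ Δ) : ∃ (k : ℕ) (Ω : Tel T.S Γ.len k)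
    (h : WF T.H (Γ.ctx.append Ω)) (e : Δ = Γ.append Ω h), Θ.proj = eqToHom e ≫ dropN Γ Ω h := by
  induction Θ with
  | nil => exact ⟨0, .nil, Γ.wf, rfl, by simp [DepCxt.proj]; rfl⟩
  | snoc Θ A ih =>
    obtain ⟨k, Ω, h, e, he⟩ := ih
    subst e
    refine ⟨k + 1, Ω.snoc (ofTy A).1, ⟨h, (ofTy A).2⟩, rfl, ?_⟩
    rw [DepCxt.proj, he]
    exact (congrArg (proj A ≫ ·) (Category.id_comp _)).trans (Category.id_comp _).symm

theorem isPullback_upN {Δ Γ : T.Cxt} {σ : Fin Γ.len → Expr T.S Δ.len}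
    (hσ : IsSub T.H Δ.ctx Γ.ctx σ) {k : ℕ} (Θ : Tel T.S Γ.len k) (h : WF T.H (Γ.ctx.append Θ)) :
    IsPullback (toHom (Δ := Δ.append (Θ.subst σ) (append_wf hσ Δ.wf h).1) (Γ := Γ.append Θ h)
      (upN σ k) (append_wf hσ Δ.wf h).2) (dropN Δ _ _) (dropN Γ Θ h) (toHom σ hσ) := by
  induction Θ with
  | nil =>
    have := IsPullback.of_vert_isIso (snd := 𝟙 Δ) (f := 𝟙 Γ) (fst := toHom σ hσ) (g := toHom σ hσ) ⟨by simp⟩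
    exact this
  | snoc Θ A ih =>
    exact (isPullback_up (Δ := Δ.append _ _) (Γ := Γ.append Θ h.1) (append_wf hσ Δ.wf h.1).2 h.2 rfl
      (append_wf hσ Δ.wf h).1.2).paste_vert (ih h.1)

variable {Γ : T.Cxt} {A : Expr T.S Γ.len} (hA : T.H _ Γ.ctx (.isType A))

/-- `(x, x, r(x)) : (Γ, x ∈ A) ⟶ (Γ, x ∈ A, y ∈ A, u ∈ Id_A(x, y))`. -/
def reflHom : Γ.snoc A hA ⟶ idCxt Γ A hA := toHom (reflSub T.S _) (reflSub_isSub hA)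

theorem lift_upN {k : ℕ} (Θ : Tel T.S (Γ.len + 3) k) (h : WF T.H ((Γ.ctx.idCtx A).append Θ))
    {E : T.Cxt} {C : Expr T.S E.len} (hC : T.H _ E.ctx (.isType C)) :
    HasLiftingProperty (toHom (Δ := (Γ.snoc A hA).append (Θ.subst (reflSub T.S _))
      (append_wf (reflSub_isSub hA) (Γ.snoc A hA).wf h).1) (Γ := (idCxt Γ A hA).append Θ h)
      (upN (reflSub T.S _) k) (append_wf (reflSub_isSub hA) (Γ.snoc A hA).wf h).2)
      (E.drop C hC) := by
  refine ⟨fun {a b} sq => ?_⟩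
  obtain ⟨a : Fin (E.len + 1) → Expr T.S (Γ.len + 1 + k), ha, rfl⟩ := exists_rep a
  obtain ⟨b : Fin E.len → Expr T.S (Γ.len + 3 + k), hb, rfl⟩ := exists_rep b
  have hW := (append_wf (reflSub_isSub hA) (Γ.snoc A hA).wf h).1
  have hi := (append_wf (reflSub_isSub hA) (Γ.snoc A hA).wf h).2
  have e := toHom_eq_iff.1 sq.w
  have hib := isSub_comp hW hi hb
  have hCb := T.substitution hC h hb
  have hc := T.substitution_type_congr hC hW ha.1 hib e
  have hd := T.tm_conv ha.2 hc
  rw [← Expr.subst_subst] at hd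
  have hj := Jat_hasType (Δ := (Γ.ctx.idCtx A).append Θ) hCb hd h
    (σ := baseOf k var) (t := telOf k var) (by rw [appendSub_eta]; exact isSub_var h)
  have hr := Jat_refl (Δ := (Γ.ctx.snoc A).append (Θ.subst (reflSub T.S _))) hCb hd hW
    (σ := baseOf k var) (t := telOf k var) (by rw [appendSub_eta]; exact isSub_var hW)
  have e1 : appendSub (fun i => (reflSub T.S Γ.len i).subst (baseOf k var)) (telOf k var) =
      upN (reflSub T.S Γ.len) k := by
    rw [← upN_appendSub, appendSub_eta]; funext i; exact subst_var _
  have e2 := appendSub_subst (baseOf k var) (telOf k var) (upN (reflSub T.S Γ.len) k)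
  rw [appendSub_eta] at e2
  have e3 := congrArg (baseOf k) (e2.trans (rfl : _ = _) |>.symm.trans e1.symm)
  have e4 := congrArg (telOf k) (e2.symm.trans e1.symm)
  rw [baseOf_appendSub, baseOf_appendSub] at e3
  rw [telOf_appendSub, telOf_appendSub] at e4
  rw [appendSub_eta, subst_var] at hj
  rw [appendSub_eta, subst_var, e1, ← e3] at hr
  have hr' := hr
  refine ⟨⟨⟨toHom (Γ := E.snoc C hC) (scons (Jat (a 0) (baseOf k var) (telOf k var)) b) ⟨hb, hj⟩, ?_, rfl⟩⟩⟩
  refine toHom_eq_iff.2 ⟨subEq_symm E.wf hW ha.1 hib e, ?_⟩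
  have e5 := Jat_subst (a 0) (baseOf k var) (telOf k var) (upN (reflSub T.S Γ.len) k)
  rw [e4] at e5
  rw [← e5] at hr
  exact (congrArg (fun B => T.H _ ((Γ.ctx.snoc A).append (Θ.subst (reflSub T.S _))) (.tmEq _ _ B))
    (Expr.subst_subst C b (upN (reflSub T.S Γ.len) k))).mp hr

theorem llp_of_iso {X Y X' Y' : T.Cxt} {f : X ⟶ Y} {f' : X' ⟶ Y'} (e : X ≅ X') (e' : Y ≅ Y')
    (h : e.hom ≫ f' = f ≫ e'.hom) (hf : Display.llp f') : Display.llp f := by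
  have : f = e.hom ≫ f' ≫ e'.inv := by rw [← Category.assoc, h]; simp
  rw [this]
  exact Display.llp.comp_mem _ _ (MorphismProperty.llp_of_isIso _ _)
    (Display.llp.comp_mem _ _ hf (MorphismProperty.llp_of_isIso _ _))

theorem isSub_up3 {A : Expr T.S Γ.len} (hA : T.H _ Γ.ctx (.isType A)) {Δ : T.Cxt} {σ : Fin Γ.len → Expr T.S Δ.len} (hσ : IsSub T.H Δ.ctx Γ.ctx σ) :
    IsSub T.H (Δ.ctx.idCtx (A.subst σ)) (Γ.ctx.idCtx A) (up (up (up σ))) :=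
  (idCtx_subst hσ Δ.wf (idCtx_wf hA)).2

def idDrop : idCxt Γ A hA ⟶ Γ.snoc A hA :=
  (Cxt.drop (Cxt.snoc (Γ.snoc A hA) _ (idCtx_wf hA).1.2) _ (idCtx_wf hA).2) ≫ Cxt.drop _ _ _

theorem isPullback_id {Δ : T.Cxt} {σ : Fin Γ.len → Expr T.S Δ.len} (hσ : IsSub T.H Δ.ctx Γ.ctx σ)
    (hA' : T.H _ Δ.ctx (.isType (A.subst σ))) :
    IsPullback (toHom (Δ := idCxt Δ (A.subst σ) hA') (Γ := idCxt Γ A hA) (up (up (up σ)))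
      (isSub_up3 hA hσ)) (idDrop hA') (idDrop hA) (toHom (Δ := Δ.snoc _ hA') (Γ := Γ.snoc A hA)
        (up σ) (isSub_up' hσ rfl hA')) := by
  have e1 := wk_up σ A
  have e2 := wk_up (up σ) (A.subst (wk T.S _))
  rw [e1] at e2
  have h1 := isPullback_up (Δ := Δ.snoc _ hA') (Γ := Γ.snoc A hA) (isSub_up' hσ rfl hA')
    (idCtx_wf hA).1.2 e1 (idCtx_wf hA').1.2
  have h2 := isPullback_up (Δ := Cxt.snoc (Δ.snoc _ hA') _ (idCtx_wf hA').1.2)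
    (Γ := Cxt.snoc (Γ.snoc A hA) _ (idCtx_wf hA).1.2) (isSub_up' (isSub_up' hσ rfl hA') e1 (idCtx_wf hA').1.2)
    (idCtx_wf hA).2 (A := idTy A) (B := idTy (A.subst σ))
    (congrArg (fun B => Expr.Id B (var 1) (var 0)) e2) (idCtx_wf hA').2
  exact h2.paste_vert h1

theorem isPullback_refl {Δ : T.Cxt} {σ : Fin Γ.len → Expr T.S Δ.len} (hσ : IsSub T.H Δ.ctx Γ.ctx σ)
    (hA' : T.H _ Δ.ctx (.isType (A.subst σ))) :
    IsPullback (reflHom hA') (toHom (Δ := Δ.snoc _ hA') (Γ := Γ.snoc A hA)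
        (up σ) (isSub_up' hσ rfl hA')) (toHom (Δ := idCxt Δ (A.subst σ) hA') (Γ := idCxt Γ A hA)
          (up (up (up σ))) (isSub_up3 hA hσ)) (reflHom hA) := by
  have h1 : ∀ {Γ : T.Cxt} {A} (hA : T.H _ Γ.ctx (.isType A)), reflHom hA ≫ idDrop hA = 𝟙 _ :=
    fun hA => rfl
  refine (IsPullback.of_bot (h₁₁ := toHom (Δ := Δ.snoc _ hA') (Γ := Γ.snoc A hA)
        (up σ) (isSub_up' hσ rfl hA')) (v₂₁ := idDrop hA') ?_ ?_ (isPullback_id hA hσ hA')).flip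
  · rw [h1, h1]; exact IsPullback.of_vert_isIso ⟨by simp⟩
  · refine congrArg (Quotient.mk _) (Subtype.ext ?_)
    exact reflSub_up σ

theorem stableElim_reflHom : StableElim (idDrop hA ≫ Γ.drop A hA) (reflHom hA) := by
  intro Γ' Y' Z W s q π' hq p hp i' p' h
  obtain ⟨σ, hσ, rfl⟩ := exists_rep s
  have hA' := T.substitution hA Γ'.wf hσ
  have hq0 := (isPullback_id hA hσ hA').paste_vert (isPullback_up hσ hA rfl hA')
  let e := hq.isoIsPullback _ _ hq0
  have he : e.hom ≫ _ = q := hq.isoIsPullback_hom_fst _ _ hq0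
  obtain ⟨Δ, Θ, ε, hε⟩ := hp.comp (DepProj.of_isIso e.hom)
  obtain ⟨k, Ω, hΩ, e', hp'⟩ := exists_tel Θ
  subst e'
  rw [eqToHom_refl, Category.id_comp] at hp'
  have h0 := (isPullback_upN (Γ := idCxt Γ' _ hA') (reflSub_isSub hA') Ω hΩ).paste_vert
    (isPullback_refl hA hσ hA')
  have h2 : IsPullback (i' ≫ ε.hom) p' (dropN (idCxt Γ' _ hA') Ω hΩ ≫
      toHom (Δ := idCxt Γ' _ hA') (Γ := idCxt Γ A hA) (up (up (up σ))) (isSub_up3 hA hσ)) (reflHom hA) := by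
    refine h.of_iso (Iso.refl _) ε (Iso.refl _) (Iso.refl _) (by simp) (by simp) ?_ (by simp)
    rw [← he, Iso.refl_hom, Category.comp_id, ← Category.assoc, ← Category.assoc, ← hp', ← hε]
  refine llp_of_iso (h2.isoIsPullback _ _ h0) ε (h2.isoIsPullback_hom_fst _ _ h0) ?_
  rintro _ _ _ ⟨C⟩
  exact lift_upN hA' Ω hΩ (ofTy C).2

end Elim

/-- The identity types of `T`. -/
instance : IdentityTypes T.Cxt where
  dbl {Γ} A := toTy (Γ.snoc (ofTy A).1 (ofTy A).2) ((ofTy A).1.subst (wk T.S _))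
    (T.weakening (ofTy A).2 (ofTy A).2)
  dblTop {Γ} A := toHom (Γ := Γ.snoc (ofTy A).1 (ofTy A).2) (up (wk T.S _))
    (isSub_up' (isSub_wk (Γ.snoc (ofTy A).1 (ofTy A).2).wf) rfl
      (T.weakening (ofTy A).2 (ofTy A).2))
  dbl_isPullback {Γ} A := isPullback_up (isSub_wk (Γ.snoc (ofTy A).1 (ofTy A).2).wf) (ofTy A).2 rfl
    (T.weakening (ofTy A).2 (ofTy A).2)
  Id {Γ} A := toTy (Cxt.snoc (Γ.snoc (ofTy A).1 (ofTy A).2) _ (idCtx_wf (ofTy A).2).1.2)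
    (idTy (ofTy A).1) (idCtx_wf (ofTy A).2).2
  refl {Γ} A := reflHom (ofTy A).2
  refl_fst A := rfl
  refl_snd A := by
    refine congrArg (Quotient.mk _) (Subtype.ext ?_)
    exact refl_snd_aux _ _
  elim {Γ} A := by
    have := stableElim_reflHom (ofTy A).2
    have e : ∀ {X Y Z W : T.Cxt} (f : X ⟶ Y) (g : Y ⟶ Z) (h : Z ⟶ W),
      (f ≫ g) ≫ h = f ≫ g ≫ h := fun f g h => Category.assoc f g h
    exact (congrArg (StableElim · _) (e _ _ _)).mp this

end

variable (T)

/-- The left class of the identity type weak factorisation system: the maps with the left lifting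
property with respect to all display maps. -/
def classA : MorphismProperty T.Cxt := (Display (C := T.Cxt)).llp

/-- The right class of the identity type weak factorisation system: the maps with the right lifting
property with respect to all maps in the left class. -/
def classB : MorphismProperty T.Cxt := T.classA.rlp

end DependentTypeTheory

end TypeTheory

namespace TypeTheory

open ContextCategory IdentityTypes

section Abstract

variable {C : Type u} [Category.{u} C] [ContextCategory C]

/-! Maps in 𝒜 are inclusions of strong deformation retracts and maps in ℬ lift paths; evaluation at
global elements turns both facts into statements about groupoids.

For (i): a map with the left lifting property against display maps has it against all dependent
projections. Every context projects to the empty one by such a map, so `f` in 𝒜 has a retraction `r`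
(`exists_retraction`). The identity context is also given by a dependent projection, so the constant
path on `f` extends to a homotopy from `r ≫ f` to the identity (`exists_deformation`). The equation
`f ≫ r = 𝟙` gives injectivity on objects and one composite of the equivalence, on the nose;
naturality of the homotopy (`op_ap_homotopy`) gives the other.

For (ii): let `P` be the mapping path context of `f`, whose elements are pairs of a point `x` of `Φ`
and a path `u` in `Ψ` starting at `f x`. If the unit `i : Φ ⟶ P` is in 𝒜, lifting against `f` in ℬ
yields `ρ : P ⟶ Φ` with `i ≫ ρ = 𝟙` and with `ρ (x, u)` strictly over the endpoint of `u`. Applying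
`ρ` to the deformation of `P` onto `Φ` gives a path from `x` to `ρ (x, u)`. Its image in `Ψ` is
homotopic to `u`, because the two agree along `i` and `i` is in 𝒜 (`exists_path_lifting`). In a
groupoid, lifts of morphisms are automatically cartesian, so this gives a fibration.

The main point is that `i` is in 𝒜 (`llp_mappingPath`). It is a base change of reflexivity along an
arbitrary `f`, whereas elimination for the identity context of `Ψ` allows only base change of its
ambient context, here the empty one, and parameters, that is, base change along dependent
projections. The remedy is to contract based paths. The context `(y, u)` relative to `x ∈ Ψ` has its
own identity context relative to `Ψ`, whose elimination rule may be base changed along any map into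
`Ψ`. Elimination on `u` gives there a path from `(x, r(x))` to `(y, u)`, and transport along it
fills the lifting problems (`llp_of_contraction`). -/

theorem exists_lift_of_llp {X Y E B : C} {i : X ⟶ Y} (hi : Display.llp i) {e : E ⟶ B}
    (he : DepProj e) (t : X ⟶ E) (b : Y ⟶ B) (w : t ≫ e = i ≫ b) :
    ∃ l : Y ⟶ E, i ≫ l = t ∧ l ≫ e = b := by
  have := llp_depProj hi _ he
  have sq : CommSq t i e b := ⟨w⟩
  exact ⟨sq.lift, sq.fac_left, sq.fac_right⟩

/-! ### Extending paths along maps of the left class -/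

namespace IdCxt

variable {Γ Δ : C} {Θ : DepCxt Γ Δ} (I : IdCxt Θ)

/-- This is the elimination rule with trivial base change and no parameters. -/
theorem llp_refl : Display.llp I.refl :=
  I.elim (𝟙 Γ) (𝟙 _) (I.tel.proj ≫ Θ.fst ≫ Θ.proj) (IsPullback.of_horiz_isIso ⟨by simp⟩)
    (𝟙 _) (DepProj.of_isIso _) I.refl (𝟙 _) (by simpa using I.refl_isPullback)

/-- A path from `x` to `y` is a lift of the pair `(x, y)` through the dependent projection
`I.tel.proj`, so a path given on `X` extends along `i`. This is the form in which left lifting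
properties are used to construct homotopies. -/
theorem exists_path_of_llp {X Y : C} {i : X ⟶ Y} (hi : Display.llp i) (t : X ⟶ I.obj)
    (x y : Y ⟶ Δ) (hxy : x ≫ Θ.proj = y ≫ Θ.proj)
    (hx : t ≫ I.src = i ≫ x) (hy : t ≫ I.tgt = i ≫ y) :
    ∃ l : Y ⟶ I.obj, i ≫ l = t ∧ l ≫ I.src = x ∧ l ≫ I.tgt = y := by
  -- The square `isPullback_sq` lists `snd` before `fst`, so the target `y` comes first.
  obtain ⟨l, h, h'⟩ := exists_lift_of_llp hi I.tel.depProj t (Θ.isPullback_sq.lift y x hxy.symm) (by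
    apply Θ.isPullback_sq.hom_ext
    · simpa [tgt] using hy
    · simpa [src] using hx)
  exact ⟨l, h, by simp [src, reassoc_of% h'], by simp [tgt, reassoc_of% h']⟩

theorem joined_of_llp {X Y : C} {i : X ⟶ Y} (hi : Display.llp i) {p q : Y ⟶ Δ}
    (hpq : p ≫ Θ.proj = q ≫ Θ.proj) (h : I.Joined (i ≫ p) (i ≫ q)) : I.Joined p q := by
  obtain ⟨t, h1, h2⟩ := h
  obtain ⟨l, -, hl⟩ := I.exists_path_of_llp hi t p q hpq h1 h2
  exact ⟨l, hl⟩

end IdCxt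

/-! ### Retractions, path contraction and mapping path contexts -/

/-- Every context is fibrant: its map to the empty context is a dependent projection, so the
identity of `Φ` extends along `i`. -/
theorem exists_retraction [Contextual C] {Φ Ψ : C} {i : Φ ⟶ Ψ} (hi : Display.llp i) :
    ∃ r : Ψ ⟶ Φ, i ≫ r = 𝟙 Φ := by
  obtain ⟨r, h, -⟩ := exists_lift_of_llp hi (Contextual.cxt Φ).depProj (𝟙 Φ)
    (isTerminal.from _) (isTerminal.hom_ext _ _)
  exact ⟨r, h⟩

/-- Path contraction: if `p : E ⟶ B` is a dependent projection with a section `i` and the identity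
type of `E` relative to `B` contains a path from `i (p e)` to `e` that is constant along `i`, then every
base change of `i` has the left lifting property with respect to display maps. -/
theorem llp_of_contraction {B E : C} {S : DepCxt B E} (K : IdCxt S) {r : B ⟶ E}
    {c : E ⟶ K.obj} (hcs : c ≫ K.src = S.proj ≫ r) (hct : c ≫ K.tgt = 𝟙 E)
    (hrc : r ≫ c = r ≫ K.refl) {A P : C} {f : A ⟶ B} {g : P ⟶ E} {π : P ⟶ A}
    (hP : IsPullback g π S.proj f) {i : A ⟶ P} (hig : i ≫ g = f ≫ r) (hiπ : i ≫ π = 𝟙 A) :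
    Display.llp i := by
  -- `Q` is the base change of the identity context `K` along `f`, that is, the paths of `P`
  -- relative to `A`. Below, `s'`, `t'`, `r'` and `c'` are its source, target, reflexivity and
  -- contraction.
  obtain ⟨Q, q, π', hQ⟩ := (K.depProj_src.comp S.depProj).exists_pullback f
  -- The contraction is a map over `B`: the source of a path has the same projection to `B` as its
  -- target, which here is the given point. This is what allows it to be base changed to `c'`.
  have hc : c ≫ K.src ≫ S.proj = S.proj := by
    rw [K.src_proj, ← Category.assoc, hct, Category.id_comp]
  let s' : Q ⟶ P := hP.lift (q ≫ K.src) π' (by simpa using hQ.w)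
  let t' : Q ⟶ P := hP.lift (q ≫ K.tgt) π' (by simpa [K.src_proj] using hQ.w)
  let r' : P ⟶ Q := hQ.lift (g ≫ K.refl) π (by simpa using hP.w)
  let c' : P ⟶ Q := hQ.lift (g ≫ c) π (by simpa [hc] using hP.w)
  have hr' : IsPullback r' g q K.refl :=
    (IsPullback.of_bot (h₁₁ := g) (v₁₁ := r') (v₂₁ := π') (by simpa [r'] using hP)
      (by simp [r']) hQ).flip
  have hrs : r' ≫ s' = 𝟙 P := by apply hP.hom_ext <;> simp [r', s', reassoc_of% (hQ.lift_fst)]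
  have hrt : r' ≫ t' = 𝟙 P := by apply hP.hom_ext <;> simp [r', t', reassoc_of% (hQ.lift_fst)]
  have hcs' : c' ≫ s' = π ≫ i := by
    apply hP.hom_ext
    · simp [c', s', reassoc_of% (hQ.lift_fst), hcs, hig, reassoc_of% hP.w]
    · simp [c', s', hiπ]
  have hct' : c' ≫ t' = 𝟙 P := by
    apply hP.hom_ext <;> simp [c', t', reassoc_of% (hQ.lift_fst), hct]
  -- The contraction is constant along `i`; this will make the lift agree with `t` strictly on `A`.
  have hic : i ≫ c' = i ≫ r' := by
    apply hQ.hom_ext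
    · simp [c', r', reassoc_of% hig, hrc]
    · simp [c', r']
  rintro _ _ _ ⟨D⟩
  refine ⟨fun {t b} sq => ?_⟩
  -- Pulling `D` back along `b` reduces the problem to finding a section over `P` that extends the
  -- partial section `u` along `i`.
  have hD := ContextCategory.isPullback b D
  let e := proj (sub b D)
  have he : DepProj e := depProj_proj _
  let u : A ⟶ ext (sub b D) := hD.lift t i sq.w
  have hu : u ≫ e = i := hD.lift_snd _ _ _
  -- `Z` consists of a relative path in `P` with an element of the type over its source; `j` pairs
  -- an element with the constant path.
  obtain ⟨Z, z, p, hZ⟩ := he.exists_pullback s'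
  let j : ext (sub b D) ⟶ Z := hZ.lift (𝟙 _) (e ≫ r') (by simp [hrs])
  have hj : IsPullback j e p r' :=
    IsPullback.of_right (h₁₂ := z) (h₂₂ := s')
      (by simpa [j, hrs] using IsPullback.of_horiz_isIso ⟨by simp⟩) (by simp [j]) hZ
  -- Here the stability of elimination is used in full: `f` is the change of base and `p` supplies
  -- the parameter, the element to be transported.
  have hl := K.elim f q π' (by simpa [IdCxt.src] using hQ) p (he.baseChange hZ) j (e ≫ g)
    (hj.paste_vert hr')
  -- `τ` is transport along relative paths, the identity on constant ones.
  obtain ⟨τ, h1, h2⟩ := exists_lift_of_llp hl he (𝟙 _) (p ≫ t')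
    (by simp [j, hrt])
  -- Over a point of `P`, start with the value of `u` at its projection to `A`, which lies over the
  -- source of the contracting path; transport along that path reaches the type over the given
  -- point.
  let l : P ⟶ Z := hZ.lift (π ≫ u) c' (by simp [hu, hcs'])
  have hil : i ≫ l = u ≫ j := by
    apply hZ.hom_ext
    · simp [l, j, reassoc_of% hiπ]
    · simp [l, j, reassoc_of% hu, hic]
  refine ⟨⟨⟨l ≫ τ ≫ top b D, ?_, ?_⟩⟩⟩
  · rw [reassoc_of% hil, reassoc_of% h1]; exact hD.lift_fst _ _ _
  · have : τ ≫ proj (sub b D) = p ≫ t' := h2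
    simp only [Category.assoc, hD.w, reassoc_of% this]
    simp [l, reassoc_of% hct']

variable [IdentityTypes C] [Contextual C]

/-- The unit `x ↦ (x, f x, r(f x))` of the mapping path context of `f`. -/
theorem llp_mappingPath {Φ Ψ P : C} {f : Φ ⟶ Ψ} {g : P ⟶ (pathCxt Ψ).obj} {π : P ⟶ Φ}
    (hP : IsPullback g π (pathCxt Ψ).src f) {i : Φ ⟶ P} (hig : i ≫ g = f ≫ (pathCxt Ψ).refl)
    (hiπ : i ≫ π = 𝟙 Φ) : Display.llp i := by
  -- The context `(y ∈ Ψ, u ∈ Id_Ψ(x, y))` relative to `x ∈ Ψ`. With base `Ψ` in place of the empty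
  -- context, its identity context may be base changed along `f`.
  let S : DepCxt Ψ (pathCxt Ψ).obj :=
    ((Contextual.cxt Ψ).pull (Contextual.cxt Ψ).proj).tel.append (pathCxt Ψ).tel
  have hS : S.proj = (pathCxt Ψ).src := DepCxt.append_proj _ _
  -- Contraction of based paths: a path from `(x, r(x))` to `(y, u)` by elimination on `u`, taken to
  -- be reflexivity when `u` is `r(x)`.
  obtain ⟨c, h1, h2, h3⟩ := (IdCxt.of S).exists_path_of_llp (pathCxt Ψ).llp_refl
    ((pathCxt Ψ).refl ≫ (IdCxt.of S).refl) ((pathCxt Ψ).src ≫ (pathCxt Ψ).refl) (𝟙 _)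
    (by simp [hS]) (by simp) (by simp)
  exact llp_of_contraction (IdCxt.of S) (by rw [h2, hS]) h3 h1 (by rwa [hS]) hig hiπ

/-- A map with the left lifting property with respect to display maps is a strong deformation retract. -/
theorem exists_deformation {Φ Ψ : C} {i : Φ ⟶ Ψ} (hi : Display.llp i) {r : Ψ ⟶ Φ}
    (hr : i ≫ r = 𝟙 Φ) : ∃ h : Ψ ⟶ (pathCxt Ψ).obj, i ≫ h = i ≫ (pathCxt Ψ).refl ∧
      h ≫ (pathCxt Ψ).src = r ≫ i ∧ h ≫ (pathCxt Ψ).tgt = 𝟙 Ψ :=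
  (pathCxt Ψ).exists_path_of_llp hi _ _ _ (isTerminal.hom_ext _ _) (by simp [reassoc_of% hr])
    (by simp)

/-! ### Consequences for fundamental groupoids -/

namespace FundamentalGroupoid

variable {Φ Ψ : C}

/-- Homotopies relative to endpoints extend along the left class, so two families of paths with
common endpoints need only be compared on `X`. -/
theorem homotopic_of_llp {X Y : C} {i : X ⟶ Y} (hi : Display.llp i)
    {p q : Y ⟶ (pathCxt Φ).obj} (hs : p ≫ (pathCxt Φ).src = q ≫ (pathCxt Φ).src)
    (ht : p ≫ (pathCxt Φ).tgt = q ≫ (pathCxt Φ).tgt)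
    (h : (homotopyCxt Φ).Joined (i ≫ p) (i ≫ q)) : (homotopyCxt Φ).Joined p q :=
  (homotopyCxt Φ).joined_of_llp hi ((pathCxt Φ).tel_ext hs ht) h

/-- Naturality of a homotopy `h : k ∼ 𝟙`. -/
theorem op_ap_homotopy {k : Ψ ⟶ Φ} {f : Φ ⟶ Ψ} {h : Ψ ⟶ (pathCxt Ψ).obj}
    (hs : h ≫ (pathCxt Ψ).src = k ≫ f) (ht : h ≫ (pathCxt Ψ).tgt = 𝟙 Ψ) :
    (homotopyCxt Ψ).Joined
      ((pathCxt Ψ).composition.op (ap k ≫ ap f) ((pathCxt Ψ).tgt ≫ h)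
        (by simp [hs, reassoc_of% (ap_tgt k)]))
      ((pathCxt Ψ).composition.op ((pathCxt Ψ).src ≫ h) (𝟙 _) (by simp [ht])) := by
  -- By elimination on the path, it suffices to check the naturality square on reflexivity.
  refine homotopic_of_llp (pathCxt Ψ).llp_refl ?_ ?_ ?_
  · simp [IdCxt.Composition.op_src, hs, reassoc_of% (ap_src k)]
  · simp [IdCxt.Composition.op_tgt, ht]
  · have e1 : (pathCxt Ψ).refl ≫ ap k ≫ ap f = (h ≫ (pathCxt Ψ).src) ≫ (pathCxt Ψ).refl := by
      rw [reassoc_of% (refl_ap k), refl_ap, hs, Category.assoc]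
    have e2 : (pathCxt Ψ).refl ≫ 𝟙 _ = 𝟙 Ψ ≫ (pathCxt Ψ).refl := by simp
    simp only [IdCxt.Composition.precomp, e1, e2, IdCxt.refl_src_assoc, IdCxt.refl_tgt_assoc,
      IdCxt.Composition.op_refl]
    -- The right unit law is strict, so one side has become `h` itself; the left unit law holds only
    -- up to homotopy.
    exact refl_op h

/-- The natural isomorphism induced by a homotopy `h : k ≫ f ∼ 𝟙`. -/
noncomputable def isoOfHomotopy {k : Ψ ⟶ Φ} {f : Φ ⟶ Ψ} {h : Ψ ⟶ (pathCxt Ψ).obj}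
    (hs : h ≫ (pathCxt Ψ).src = k ≫ f) (ht : h ≫ (pathCxt Ψ).tgt = 𝟙 Ψ) :
    map k ⋙ map f ≅ 𝟭 (FundamentalGroupoid Ψ) :=
  NatIso.ofComponents
    (fun b => (Groupoid.isoEquivHom ((map k ⋙ map f).obj b) b).symm
      (Quotient.mk _ (⟨b.pt ≫ h, by simp [hs, map], by simp [ht]⟩ : Path _ _)))
    (by
      intro b b' p
      induction p using Quotient.inductionOn with | _ p
      refine Quotient.sound ?_
      -- The universal naturality square, evaluated at the path `p`.
      have := (op_ap_homotopy hs ht).precomp p.1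
      simp only [IdCxt.Composition.precomp, Category.comp_id] at this
      simp only [← Category.assoc, p.2.1, p.2.2] at this
      exact this)

theorem isEquivalence_map {f : Φ ⟶ Ψ} (hf : Display.llp f) : (map f).IsEquivalence := by
  obtain ⟨r, hr⟩ := exists_retraction hf
  obtain ⟨h, -, hs, ht⟩ := exists_deformation hf hr
  -- The unit is an equality of functors because `f ≫ r = 𝟙`; only the counit needs the homotopy.
  exact (CategoryTheory.Equivalence.mk (map f) (map r)
    (eqToIso (by rw [← map_comp', hr, map_id'])) (isoOfHomotopy hs ht)).isEquivalence_functor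

theorem injective_map_obj {f : Φ ⟶ Ψ} (hf : Display.llp f) : Function.Injective (map f).obj := by
  obtain ⟨r, hr⟩ := exists_retraction hf
  intro a b e
  have e' : a.pt ≫ f = b.pt ≫ f := congrArg FundamentalGroupoid.pt e
  apply FundamentalGroupoid.ext
  simpa [hr] using congrArg (· ≫ r) e'

/-- Maps with the right lifting property with respect to the left class lift paths: `ρ` is the endpoint
and `l` the lift. -/
theorem exists_path_lifting {f : Φ ⟶ Ψ} (hf : (Display (C := C)).llp.rlp f) {P : C}
    {g : P ⟶ (pathCxt Ψ).obj} {π : P ⟶ Φ} (hP : IsPullback g π (pathCxt Ψ).src f) :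
    ∃ (ρ : P ⟶ Φ) (l : P ⟶ (pathCxt Φ).obj), ρ ≫ f = g ≫ (pathCxt Ψ).tgt ∧
      l ≫ (pathCxt Φ).src = π ∧ l ≫ (pathCxt Φ).tgt = ρ ∧
      (homotopyCxt Ψ).Joined (l ≫ ap f) g := by
  -- The unit `x ↦ (x, r(f x))` of the mapping path context, with retraction `π`.
  let i : Φ ⟶ P := hP.lift (f ≫ (pathCxt Ψ).refl) (𝟙 Φ) (by simp)
  have hig : i ≫ g = f ≫ (pathCxt Ψ).refl := hP.lift_fst _ _ _
  have hiπ : i ≫ π = 𝟙 Φ := hP.lift_snd _ _ _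
  have hi : Display.llp i := llp_mappingPath hP hig hiπ
  have := hf _ hi
  -- The diagonal of this square is the endpoint map `ρ`: it fixes `Φ` and lies over the endpoint of
  -- the given path.
  have sq : CommSq (𝟙 Φ) i f (g ≫ (pathCxt Ψ).tgt) := ⟨by simp [reassoc_of% hig]⟩
  -- `h` is a path in `P` from `i (π z)` to `z`; its image under `ρ` runs from `π z` to `ρ z`, since
  -- `i ≫ ρ = 𝟙`.
  obtain ⟨h, h1, h2, h3⟩ := exists_deformation hi hiπ
  have hρ := sq.fac_right
  have hiρ := sq.fac_left
  generalize sq.lift = ρ at hρ hiρ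
  have hls : (h ≫ ap ρ) ≫ (pathCxt Φ).src = π := by
    rw [Category.assoc, ap_src, reassoc_of% h2, hiρ, Category.comp_id]
  have hlt : (h ≫ ap ρ) ≫ (pathCxt Φ).tgt = ρ := by
    rw [Category.assoc, ap_tgt, reassoc_of% h3]
  refine ⟨ρ, h ≫ ap ρ, hρ, hls, hlt, homotopic_of_llp hi ?_ ?_ ?_⟩
  · rw [Category.assoc, ap_src, ← Category.assoc, hls, hP.w]
  · rw [Category.assoc, ap_tgt, ← Category.assoc, hlt, hρ]
  · have : i ≫ (h ≫ ap ρ) ≫ ap f = i ≫ g := by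
      rw [Category.assoc, reassoc_of% h1, reassoc_of% (refl_ap ρ), refl_ap, reassoc_of% hiρ, hig]
    rw [this]
    exact (homotopyCxt Ψ).joined_refl _

/-- Path lifting at a global element of the mapping path context. The endpoint lies over `b` by an
equality, as a fibration requires, whereas the lifted path need lie over `q` only up to homotopy,
since maps are homotopy classes. -/
theorem exists_lift_map {f : Φ ⟶ Ψ} (hf : (Display (C := C)).llp.rlp f) {a : FundamentalGroupoid Φ}
    {b : FundamentalGroupoid Ψ} (q : (map f).obj a ⟶ b) :
    ∃ (a' : FundamentalGroupoid Φ) (p : a ⟶ a'), (map f).IsHomLift q p := by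
  obtain ⟨P, g, π, hP⟩ := (pathCxt Ψ).depProj_src.exists_pullback f
  obtain ⟨ρ, l, hρ, hls, hlt, hl⟩ := exists_path_lifting hf hP
  induction q using Quotient.inductionOn with | _ q
  obtain ⟨q, hqs, hqt⟩ := q
  -- The global element `(a, q)` of `P`.
  let s : empty ⟶ P := hP.lift q a.pt hqs
  have hsg : s ≫ g = q := hP.lift_fst _ _ _
  have hsπ : s ≫ π = a.pt := hP.lift_snd _ _ _
  have hb : (map f).obj ⟨s ≫ ρ⟩ = b := by
    apply FundamentalGroupoid.ext
    change (s ≫ ρ) ≫ f = b.pt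
    rw [Category.assoc, hρ, reassoc_of% hsg, hqt]
  subst hb
  refine ⟨⟨s ≫ ρ⟩, Quotient.mk _ (⟨s ≫ l, by simp [hls, hsπ], by simp [hlt]⟩ : Path _ _), ?_⟩
  refine IsHomLift.of_fac' _ _ _ rfl rfl ?_
  simp only [eqToHom_refl, Category.id_comp, Category.comp_id]
  refine Quotient.sound ?_
  have := hl.precomp s
  rw [hsg, ← Category.assoc] at this
  exact this

theorem isFibered_map {f : Φ ⟶ Ψ} (hf : (Display (C := C)).llp.rlp f) : (map f).IsFibered := by
  refine Functor.IsFibered.of_exists_isStronglyCartesian fun a R q => ?_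
  -- Path lifting prescribes the source, while a cartesian lift prescribes the target; so `inv q` is
  -- lifted and the result inverted. The lift is an isomorphism, hence strongly cartesian.
  obtain ⟨a', p, hp⟩ := exists_lift_map hf (inv q)
  have : (map f).IsHomLift q (inv p) := by
    have : (map f).IsHomLift (asIso (inv q)).hom (asIso p).hom := hp
    have := IsHomLift.inv_lift_inv (map f) (asIso (inv q)) (asIso p)
    simpa using this
  exact ⟨a', inv p, inferInstance⟩

end FundamentalGroupoid

end Abstract

end TypeTheory

/-! ### The theorem for the classifying category -/

open TypeTheory in
theorem mainTheorem3 (T : DependentTypeTheory.{u}) {Φ Ψ : T.Cxt} (f : Φ ⟶ Ψ) :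
    (T.classA f →
      Functor.IsEquivalence
        (fundamentalGroupoid.map f : fundamentalGroupoid.obj Φ ⥤ fundamentalGroupoid.obj Ψ) ∧
      Function.Injective
        (fundamentalGroupoid.map f : fundamentalGroupoid.obj Φ ⥤ fundamentalGroupoid.obj Ψ).obj) ∧
    (T.classB f →
      Functor.IsFibered
        (fundamentalGroupoid.map f : fundamentalGroupoid.obj Φ ⥤ fundamentalGroupoid.obj Ψ)) :=
  -- `classA` and `classB` unfold to `Display.llp` and `Display.llp.rlp` in `T.Cxt`, so the results
  -- for an abstract category of contexts apply directly.
  ⟨fun hf => ⟨FundamentalGroupoid.isEquivalence_map hf, FundamentalGroupoid.injective_map_obj hf⟩,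
    FundamentalGroupoid.isFibered_map⟩
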